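/- **Notation.** Let $m,d\in\mathbb N$ and $0<T\le 1$. For $0<\beta\le 1$, $H_\beta([0,T])$ is the set of functions $f$ on $[0,T]$ with $\sup_{s\ne t}|f(s)-f(t)|/|s-t|^\beta<\infty$. For $k,n\ge 0$ put $t_{k,n}=n2^{-k}$ and, for a continuous scalar function $g$, $h_{k,n}(g)=2^k\int_{t_{k,n}}^{t_{k,n+1}}g(\tau)\,d\tau$. *Integral.* For $0\le a\le b\le T$ and $k\ge1$ let $n_k(a)\le\dots\le n_k(b)$ be the consecutive integers $n$, $0\le n\le 2^k$, with $[t_{k-1,\lfloor n/2\rfloor},t_{k-1,\lfloor n/2\rfloor+1}]\subset[a,b]$. For $f=f(t,\xi)$ continuous in $\xi$ define $$\int_a^b f(t,g(t))\,dg(t)=\lim_{k\to\infty}\ \sum_{n=n_k(a)+1}^{n_k(b)}\ \int_{h_{k,n-1}(g)}^{h_{k,n}(g)}f(t_{k,n},\xi)\,d\xi$$ whenever the limit exists (an empty sum is $0$). *Class of drivers.* For $\beta,\gamma>0$, $G_{\beta,\gamma}$ is the set of continuous $x:[0,T]\to\mathbb R^d$ for which there is a constant $C$ with $\mu(x_j,a,b,\beta)\le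 C(b-a)^{\beta+\gamma}$ for all $0\le a<b\le T$ and $1\le j\le d$, where $$\mu(g,a,b,\beta)=\sum_{k=k_0+1}^\infty 2^{-(k+1)\beta}\sum_{\substack{1\le n\le 2^k\\ [t_{k,n-1},t_{k,n}]\subset[a,b]}}|h_{k+1,2(n-1)}(g)-h_{k+1,2(n-1)+1}(g)|$$ and the bound is required for every integer $k_0\ge0$ with $2^{-k_0-1}\le b-a\le 2^{-k_0+1}$. **Theorem 3.2 (Uniqueness).** Let $0<\beta\le\alpha\le1$, $0<\theta\le1$, $\gamma>0$ and $0<\beta-\gamma<\beta_0<\theta\beta$. Let $F=(F_{ij}):[0,\infty)\times\mathbb R^m\times\mathbb R^d\to\mathbb R^{m\times d}$ satisfy, for all $i,j$: 1. $F_{ij}$ is continuous. 2. For every $R>0$ there is $C$ such that for all $t,t'\in[0,1]$, all $y,y'\in\mathbb R^m$ and all $x,x'\in\mathbb R^d$ with $|x|,|x'|\le R$ and $x_j=x'_j$, $$|F_{ij}(t,y,x)-F_{ij}(t',y',x')|\le C\big(|t-t'|^\theta+|y-y'|^\theta+|x-x'|^\theta\big).$$ 3. $F_{ij}$ is differentiable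 in $y$, and for every $R>0$ there is $C$ such that for all $t,t'\in[0,1]$, $|y|,|y'|,|x|,|x'|\le R$ with $x_j=x'_j$, $$|D_yF_{ij}(t,y,x)-D_yF_{ij}(t',y',x')|\le C\big(|t-t'|^\theta+|y-y'|^\theta+|x-x'|^\theta\big).$$ Then for every $x:[0,T]\to\mathbb R^d$ with $x\in G_{\beta_0,\gamma}\cap H_\alpha([0,T])$ and every $y_0\in\mathbb R^m$ there is exactly one $y\in H_\beta([0,T],\mathbb R^m)$ which solves $dy(t)=F(t,y(t),x(t))\,dx(t)$, $y(0)=y_0$, on $[0,T]$, that is, such that for all $t\in[0,T]$ and $1\le i\le m$ the integrals below exist and $$y_i(t)=(y_0)_i+\sum_{j=1}^d\int_0^tF_{ij}(u,y(u),x(u))\,dx_j(u),$$ where the $(i,j)$ integral is the one above with $g=x_j$ and $f(u,\xi)=F_{ij}(u,y(u),x_1(u),\dots,x_{j-1}(u),\xi,x_{j+1}(u),\dots,x_d(u))$. -/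

import Mathlib

open Set Filter Topology
open scoped NNReal

noncomputable section

namespace IrregularPath

/-- The dyadic point `t_{k,n} = n 2^{-k}`. -/
def dyadic (k n : ℕ) : ℝ := (n : ℝ) / 2 ^ k

/-- The dyadic mean `h_{k,n}(g) = 2^k ∫_{t_{k,n}}^{t_{k,n+1}} g`. -/
def dyadicMean (g : ℝ → ℝ) (k n : ℕ) : ℝ :=
  2 ^ k * ∫ τ in (dyadic k n)..(dyadic k (n + 1)), g τ

open Classical in
/-- The indices `0 ≤ n ≤ 2^k` for which the parent `[t_{k-1,⌊n/2⌋}, t_{k-1,⌊n/2⌋+1}]` of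
`[t_{k,n}, t_{k,n+1}]` is contained in `[a, b]`. These are consecutive integers
`n_k(a), …, n_k(b)` (or there are none). Only levels `k ≥ 1` are meaningful. -/
def indexSet (k : ℕ) (a b : ℝ) : Finset ℕ :=
  {n ∈ Finset.range (2 ^ k + 1) |
    a ≤ dyadic (k - 1) (n / 2) ∧ dyadic (k - 1) (n / 2 + 1) ≤ b}

open Classical in
/-- The line integral of `f(t, ξ) dξ` along the step curve `γ_k(a, b, g)`. Horizontal pieces do not
contribute, the vertical piece at `t_{k,n+1}` joins `h_{k,n}` to `h_{k,n+1}`, and the sum runs over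
all `n` with `n_k(a) ≤ n` and `n + 1 ≤ n_k(b)`. -/
def lineIntegral (f : ℝ → ℝ → ℝ) (g : ℝ → ℝ) (a b : ℝ) (k : ℕ) : ℝ :=
  ∑ n ∈ indexSet k a b with n + 1 ∈ indexSet k a b,
    ∫ ξ in (dyadicMean g k n)..(dyadicMean g k (n + 1)), f (dyadic k (n + 1)) ξ

/-- The integral `∫_a^b f(t, g(t)) dg(t)` exists and equals `I`. -/
def HasIntegral (f : ℝ → ℝ → ℝ) (g : ℝ → ℝ) (a b I : ℝ) : Prop :=
  Tendsto (lineIntegral f g a b) atTop (𝓝 I)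

/-- `f ∈ H_β([0, T])`, for `β > 0`. -/
def MemHolder {E : Type*} [PseudoMetricSpace E] (β T : ℝ) (f : ℝ → E) : Prop :=
  ∃ C : ℝ≥0, HolderOnWith C β.toNNReal f (Icc 0 T)

open Classical in
/-- `∑ |h_{k+1,2n}(g) - h_{k+1,2n+1}(g)|` over the level-`k` dyadic subintervals
`[t_{k,n}, t_{k,n+1}]` of `[0, 1]` that are contained in `[a, b]`. -/
def levelVariation (g : ℝ → ℝ) (a b : ℝ) (k : ℕ) : ℝ :=
  ∑ n ∈ Finset.range (2 ^ k) with a ≤ dyadic k n ∧ dyadic k (n + 1) ≤ b,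
    |dyadicMean g (k + 1) (2 * n) - dyadicMean g (k + 1) (2 * n + 1)|

/-- The term of level `k` in the series for `μ(g, a, b, β)`. -/
def muTerm (g : ℝ → ℝ) (a b β : ℝ) (k : ℕ) : ℝ :=
  (2 : ℝ) ^ (-((k : ℝ) + 1) * β) * levelVariation g a b k

/-- `x ∈ G_{β,γ}([0, T], ℝ^d)`: `x` is continuous and `μ(x_j, a, b, β) ≤ C (b - a)^{β+γ}`, where
`μ(g, a, b, β) = ∑_{k ≥ k₀+1} muTerm g a b β k` is required to converge and
`2^{-k₀-1} ≤ b - a ≤ 2^{-k₀+1}`. -/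
def MemG {d : ℕ} (β γ T : ℝ) (x : ℝ → Fin d → ℝ) : Prop :=
  ContinuousOn x (Icc 0 T) ∧
  ∃ C : ℝ, ∀ a b : ℝ, 0 ≤ a → a < b → b ≤ T → ∀ j : Fin d, ∀ k₀ : ℕ,
    1 / 2 ^ (k₀ + 1) ≤ b - a → b - a ≤ 2 / 2 ^ k₀ →
      Summable (fun i : ℕ => muTerm (fun s => x s j) a b β (k₀ + 1 + i)) ∧
      ∑' i : ℕ, muTerm (fun s => x s j) a b β (k₀ + 1 + i) ≤ C * (b - a) ^ (β + γ)

/-- The assumptions on the coefficient `F : ℝ₊ × ℝ^m × ℝ^d → L(ℝ^d, ℝ^m)`, written in matrix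
components `F_{ij}`. Only finiteness of the constants matters, so the norm chosen on `ℝ^m` and
`ℝ^d` is irrelevant. -/
structure IsAdmissible {m d : ℕ} (θ : ℝ)
    (F : ℝ → (Fin m → ℝ) → (Fin d → ℝ) → Matrix (Fin m) (Fin d) ℝ) : Prop where
  /-- Each `F_{ij}` is jointly continuous on `ℝ₊ × ℝ^m × ℝ^d`. -/
  continuous : ∀ i j, ContinuousOn
    (fun p : ℝ × (Fin m → ℝ) × (Fin d → ℝ) => F p.1 p.2.1 p.2.2 i j) (Ici 0 ×ˢ univ)
  /-- `F_{ij}` is `θ`-Hölder in `t`, `y` and the `x_k`, `k ≠ j`, locally uniformly in `x_j`;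
  the constant is uniform in `y ∈ ℝ^m`. -/
  holder : ∀ i j, ∀ R : ℝ, ∃ C : ℝ, ∀ t ∈ Icc (0 : ℝ) 1, ∀ t' ∈ Icc (0 : ℝ) 1,
    ∀ y y' : Fin m → ℝ, ∀ x x' : Fin d → ℝ, ‖x‖ ≤ R → ‖x'‖ ≤ R → x j = x' j →
      |F t y x i j - F t' y' x' i j| ≤ C * (|t - t'| ^ θ + ‖y - y'‖ ^ θ + ‖x - x'‖ ^ θ)
  /-- Each `F_{ij}` is differentiable in `y`. -/
  differentiable : ∀ i j, ∀ t : ℝ, 0 ≤ t → ∀ x : Fin d → ℝ,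
    Differentiable ℝ (fun y : Fin m → ℝ => F t y x i j)
  /-- `D_y F_{ij}` is `θ`-Hölder in `t`, `y` and the `x_k`, `k ≠ j`, locally uniformly. -/
  holder_deriv : ∀ i j, ∀ R : ℝ, ∃ C : ℝ, ∀ t ∈ Icc (0 : ℝ) 1, ∀ t' ∈ Icc (0 : ℝ) 1,
    ∀ y y' : Fin m → ℝ, ‖y‖ ≤ R → ‖y'‖ ≤ R →
    ∀ x x' : Fin d → ℝ, ‖x‖ ≤ R → ‖x'‖ ≤ R → x j = x' j →
      ‖fderiv ℝ (fun z : Fin m → ℝ => F t z x i j) y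
          - fderiv ℝ (fun z : Fin m → ℝ => F t' z x' i j) y'‖
        ≤ C * (|t - t'| ^ θ + ‖y - y'‖ ^ θ + ‖x - x'‖ ^ θ)

/-- `y ∈ H_β([0, T], ℝ^m)` solves `dy = F(t, y, x) dx`, `y(0) = y₀` on `[0, T]`: for every `t` all
integrals `∫_0^t F_{ij}(u, y(u), x(u)) dx_j(u)` exist and `y_i(t)` is `y₀_i` plus their sum over
`j`. The `(i, j)` integral is the integral with
`f(u, ξ) = F_{ij}(u, y(u), x_1(u), …, ξ, …, x_d(u))` (`ξ` in place `j`) and `g = x_j`. -/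
def IsSolution {m d : ℕ} (β T : ℝ)
    (F : ℝ → (Fin m → ℝ) → (Fin d → ℝ) → Matrix (Fin m) (Fin d) ℝ)
    (x : ℝ → Fin d → ℝ) (y₀ : Fin m → ℝ) (y : ℝ → Fin m → ℝ) : Prop :=
  MemHolder β T y ∧
  ∀ t ∈ Icc 0 T, ∀ i : Fin m, ∃ I : Fin d → ℝ,
    (∀ j : Fin d, HasIntegral (fun u ξ => F u (y u) (Function.update (x u) j ξ) i j)
      (fun u => x u j) 0 t (I j)) ∧
    y t i = y₀ i + ∑ j, I j

end IrregularPath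

end

/-!
Two ideas carry the proof.

**The integral.** Passing from the step curve of level `k` to that of level `k + 1` splits each mean
`h_{k,n}` into the means over the two halves. Up to terms that telescope (`halfIntegral`), this
changes the line integral on one piece only by increments of `f` over a time `2^{-k-1}`, multiplied
by the difference of the two half means (`abs_refine_vertical_le`). If `f` is `β₀`-Hölder in time,
these errors add up to the series `μ(g, a, b, β₀)`; the boundary terms are bounded in number and
decay geometrically because `g` is `α`-Hölder (`abs_lineIntegral_succ_sub_le`). So the integral
exists, and for `|f| ≤ A` with Hölder constant `B` it is at most
`K (A (b - a)^α + B (b - a)^{β₀ + γ})` (`exists_hasIntegral`, `IsDriver.integral`). It is also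
additive over adjacent intervals (`HasIntegral.sub_left`).

**The equation.** Solutions are the fixed points of `solutionMap`. The integrand
`F_{ij}(u, y(u), x(u))` is `θβ`-Hölder in `u`, hence `β₀`-Hölder, with constants that grow at most
linearly in `y` (`IsDriver.exists_hasGrowthBound`). For two paths the difference of the integrands
is controlled by the mean value theorem and the Hölder continuity of `D_y F`
(`IsDriver.exists_hasLipschitzBound`). Since `β₀ + γ > β`, the second term of the estimate has a gain
on short time intervals. The first one need not, as `α = β` is allowed, but there the factor `A` is a
supremum norm, which is small compared with the Hölder norm of a function that vanishes at `0`. With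
local Hölder norms weighted by `e^{t/τ}` (`WeightedHolder`) this works on all of `[0, T]` at once,
without gluing local solutions: for small `τ` a ball is invariant (`exists_invariant_ball`), and
differences of paths in that ball contract by `1/2` for another choice of `τ` (`exists_contraction`),
which depends on the ball.
-/

namespace IrregularPath

/-! ### Dyadic means and the refinement of one vertical piece -/

lemma dyadic_succ_sub (k n : ℕ) : dyadic k (n + 1) - dyadic k n = (1 / 2) ^ k := by
  unfold dyadic
  push_cast
  rw [← sub_div, one_div_pow]
  ring

lemma dyadic_lt_succ (k n : ℕ) : dyadic k n < dyadic k (n + 1) := by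
  have := dyadic_succ_sub k n
  have h : (0 : ℝ) < (1 / 2) ^ k := by positivity
  linarith

lemma dyadic_mono (k : ℕ) : Monotone (dyadic k) :=
  monotone_nat_of_le_succ fun n => (dyadic_lt_succ k n).le

lemma dyadic_two_mul (k n : ℕ) : dyadic (k + 1) (2 * n) = dyadic k n := by
  unfold dyadic
  push_cast
  rw [pow_succ]
  field_simp

lemma dyadic_two_mul_add_two (k n : ℕ) : dyadic (k + 1) (2 * n + 1 + 1) = dyadic k (n + 1) := by
  rw [← dyadic_two_mul k (n + 1)]
  rfl

lemma le_dyadic_iff {a : ℝ} {k n : ℕ} : a ≤ dyadic k n ↔ ⌈a * 2 ^ k⌉₊ ≤ n := by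
  unfold dyadic
  rw [Nat.ceil_le, le_div_iff₀ (by positivity)]

lemma dyadic_le_iff {b : ℝ} (hb : 0 ≤ b) {k n : ℕ} : dyadic k n ≤ b ↔ n ≤ ⌊b * 2 ^ k⌋₊ := by
  unfold dyadic
  rw [Nat.le_floor_iff (by positivity), div_le_iff₀ (by positivity)]

lemma abs_dyadicMean_sub_le {g : ℝ → ℝ} {k n : ℕ} {c ε : ℝ}
    (hg : ContinuousOn g (Icc (dyadic k n) (dyadic k (n + 1))))
    (h : ∀ τ ∈ Icc (dyadic k n) (dyadic k (n + 1)), |g τ - c| ≤ ε) :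
    |dyadicMean g k n - c| ≤ ε := by
  have hle := (dyadic_lt_succ k n).le
  have hint : IntervalIntegrable g MeasureTheory.volume (dyadic k n) (dyadic k (n + 1)) :=
    ContinuousOn.intervalIntegrable_of_Icc hle hg
  have hsub := dyadic_succ_sub k n
  have h2 : (2 : ℝ) ^ k * (1 / 2) ^ k = 1 := by
    rw [← mul_pow]; norm_num
  have hc : dyadicMean g k n - c
      = 2 ^ k * ∫ τ in (dyadic k n)..(dyadic k (n + 1)), (g τ - c) := by
    rw [intervalIntegral.integral_sub hint intervalIntegrable_const,
      intervalIntegral.integral_const, hsub, dyadicMean, mul_sub, smul_eq_mul, ← mul_assoc, h2,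
      one_mul]
  have hb := intervalIntegral.norm_integral_le_of_norm_le_const (a := dyadic k n)
    (b := dyadic k (n + 1)) (f := fun τ => g τ - c) (C := ε) (fun τ hτ => by
      rw [uIoc_of_le hle] at hτ
      exact h τ ⟨hτ.1.le, hτ.2⟩)
  rw [hsub, Real.norm_eq_abs, abs_of_pos (by positivity : (0 : ℝ) < (1 / 2) ^ k)] at hb
  rw [hc, abs_mul, abs_of_pos (by positivity : (0 : ℝ) < 2 ^ k)]
  calc 2 ^ k * |∫ τ in (dyadic k n)..(dyadic k (n + 1)), (g τ - c)|
      ≤ 2 ^ k * (ε * (1 / 2) ^ k) := by gcongr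
    _ = ε := by rw [mul_left_comm, h2, mul_one]

lemma dyadicMean_eq_avg {g : ℝ → ℝ} {k n : ℕ}
    (hg : ContinuousOn g (Icc (dyadic k n) (dyadic k (n + 1)))) :
    dyadicMean g k n
      = (dyadicMean g (k + 1) (2 * n) + dyadicMean g (k + 1) (2 * n + 1)) / 2 := by
  have h1 := dyadic_two_mul k n
  have h2 := dyadic_two_mul_add_two k n
  have l1 := (dyadic_lt_succ (k + 1) (2 * n)).le
  have l2 := (dyadic_lt_succ (k + 1) (2 * n + 1)).le
  unfold dyadicMean
  rw [h1] at l1 ⊢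
  rw [h2] at l2 ⊢
  rw [← intervalIntegral.integral_add_adjacent_intervals
    (ContinuousOn.intervalIntegrable_of_Icc l1 (hg.mono (Icc_subset_Icc le_rfl l2)))
    (ContinuousOn.intervalIntegrable_of_Icc l2 (hg.mono (Icc_subset_Icc l1 le_rfl)))]
  ring

/-- The integral of `f(t_{k,n+1}, ·)` along the vertical piece of the step curve of level `k` which
joins the means `h_{k,n}` and `h_{k,n+1}`. -/
noncomputable def verticalIntegral (f : ℝ → ℝ → ℝ) (g : ℝ → ℝ) (k n : ℕ) : ℝ :=
  ∫ ξ in (dyadicMean g k n)..(dyadicMean g k (n + 1)), f (dyadic k (n + 1)) ξ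

/-- At level `l + 1` the line integral runs over the indices `2⌈a 2^l⌉ ≤ n < 2⌊b 2^l⌋ - 1`. The
subtraction is in `ℕ`; it truncates only if there is no dyadic interval of level `l` in `[a, b]`,
and the range is empty then. -/
lemma lineIntegral_succ {f : ℝ → ℝ → ℝ} {g : ℝ → ℝ} {a b : ℝ} (hb0 : 0 ≤ b) (hb1 : b ≤ 1)
    (l : ℕ) : lineIntegral f g a b (l + 1)
      = ∑ n ∈ Finset.Ico (2 * ⌈a * 2 ^ l⌉₊) (2 * ⌊b * 2 ^ l⌋₊ - 1),
          verticalIntegral f g (l + 1) n := by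
  unfold lineIntegral verticalIntegral
  refine Finset.sum_congr ?_ fun _ _ => rfl
  have hfl : ⌊b * 2 ^ l⌋₊ ≤ 2 ^ l := by
    have : b * 2 ^ l ≤ ((2 ^ l : ℕ) : ℝ) := by
      push_cast
      exact mul_le_of_le_one_left (by positivity) hb1
    exact (Nat.floor_le_floor this).trans (Nat.floor_natCast _).le
  ext n
  simp only [indexSet, Finset.mem_filter, Finset.mem_range, Finset.mem_Ico, Nat.add_sub_cancel,
    le_dyadic_iff, dyadic_le_iff hb0]
  generalize ⌈a * 2 ^ l⌉₊ = p at *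
  generalize ⌊b * 2 ^ l⌋₊ = q at *
  have h2 : 2 ^ (l + 1) = 2 * 2 ^ l := by ring
  rw [h2]
  omega

/-- The hypotheses on an integrator on `[a, b]`: it is `α`-Hölder with constant `H` and bounded by
`R`. -/
structure IsHolderPath (g : ℝ → ℝ) (α H R a b : ℝ) : Prop where
  nonneg : 0 ≤ H
  cont : ContinuousOn g (Icc a b)
  bound : ∀ t ∈ Icc a b, |g t| ≤ R
  holder : ∀ s ∈ Icc a b, ∀ t ∈ Icc a b, |g s - g t| ≤ H * |s - t| ^ α

/-- The hypotheses on an integrand on `[a, b]`: continuous in the second variable, and, as long as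
the second variable stays in `[-R, R]`, bounded by `A` and `β`-Hölder in time with constant `B`. -/
structure IsHolderIntegrand (f : ℝ → ℝ → ℝ) (β A B R a b : ℝ) : Prop where
  cont : ∀ t ∈ Icc a b, Continuous (f t)
  bound : ∀ t ∈ Icc a b, ∀ ξ, |ξ| ≤ R → |f t ξ| ≤ A
  holder : ∀ s ∈ Icc a b, ∀ t ∈ Icc a b, ∀ ξ, |ξ| ≤ R → |f s ξ - f t ξ| ≤ B * |s - t| ^ β

lemma half_pow_rpow (k : ℕ) (α : ℝ) : ((1 / 2 : ℝ) ^ k) ^ α = ((1 / 2 : ℝ) ^ α) ^ k := by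
  rw [← Real.rpow_natCast, ← Real.rpow_natCast, ← Real.rpow_mul (by norm_num),
    ← Real.rpow_mul (by norm_num), mul_comm]

lemma abs_integral_le_of_abs_le {φ : ℝ → ℝ} {p q R A : ℝ} (hp : |p| ≤ R) (hq : |q| ≤ R)
    (h : ∀ ξ, |ξ| ≤ R → |φ ξ| ≤ A) : |∫ ξ in p..q, φ ξ| ≤ A * |q - p| := by
  rw [← Real.norm_eq_abs]
  refine intervalIntegral.norm_integral_le_of_norm_le_const fun ξ hξ => ?_
  refine (Real.norm_eq_abs (φ ξ)).trans_le (h ξ ?_)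
  rw [abs_le] at *
  have := uIoc_subset_uIcc hξ
  rw [mem_uIcc] at this
  rcases this with h | h <;> constructor <;> linarith [h.1, h.2]

section Level

variable {f : ℝ → ℝ → ℝ} {g : ℝ → ℝ} {α H R a b β A B : ℝ}

lemma IsHolderPath.abs_dyadicMean_le (hg : IsHolderPath g α H R a b) {k n : ℕ}
    (h1 : a ≤ dyadic k n) (h2 : dyadic k (n + 1) ≤ b) : |dyadicMean g k n| ≤ R := by
  have hsub : Icc (dyadic k n) (dyadic k (n + 1)) ⊆ Icc a b := Icc_subset_Icc h1 h2
  simpa using abs_dyadicMean_sub_le (c := 0) (hg.cont.mono hsub)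
    (fun τ hτ => by simpa using hg.bound τ (hsub hτ))

lemma IsHolderPath.abs_dyadicMean_sub_le (hg : IsHolderPath g α H R a b) (hα : 0 ≤ α) {k n : ℕ}
    {c : ℝ} (h1 : a ≤ dyadic k n) (h2 : dyadic k (n + 1) ≤ b)
    (hc : c ∈ Icc (dyadic k n) (dyadic k (n + 1))) :
    |dyadicMean g k n - g c| ≤ H * ((1 / 2) ^ α) ^ k := by
  have hsub : Icc (dyadic k n) (dyadic k (n + 1)) ⊆ Icc a b := Icc_subset_Icc h1 h2
  refine IrregularPath.abs_dyadicMean_sub_le (hg.cont.mono hsub) fun τ hτ => ?_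
  refine (hg.holder τ (hsub hτ) c (hsub hc)).trans ?_
  rw [← half_pow_rpow]
  refine mul_le_mul_of_nonneg_left (Real.rpow_le_rpow (abs_nonneg _) ?_ hα) hg.nonneg
  rw [← dyadic_succ_sub k n, abs_le]
  constructor <;> linarith [hτ.1, hτ.2, hc.1, hc.2]

lemma IsHolderPath.abs_dyadicMean_succ_sub_le (hg : IsHolderPath g α H R a b) (hα : 0 ≤ α)
    {k n : ℕ} (h1 : a ≤ dyadic k n) (h2 : dyadic k (n + 2) ≤ b) :
    |dyadicMean g k (n + 1) - dyadicMean g k n| ≤ 2 * H * ((1 / 2) ^ α) ^ k := by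
  have l1 := (dyadic_lt_succ k n).le
  have l2 := (dyadic_lt_succ k (n + 1)).le
  have e1 := hg.abs_dyadicMean_sub_le hα h1 (l2.trans h2) (right_mem_Icc.2 l1)
  have e2 := hg.abs_dyadicMean_sub_le hα (h1.trans l1) h2 (left_mem_Icc.2 l2)
  rw [abs_le] at *
  constructor <;> linarith [e1.1, e1.2, e2.1, e2.2]

lemma abs_verticalIntegral_le (hg : IsHolderPath g α H R a b) (hα : 0 ≤ α)
    (hf : IsHolderIntegrand f β A B R a b) (hA : 0 ≤ A)
    {k n : ℕ} (h1 : a ≤ dyadic k n) (h2 : dyadic k (n + 2) ≤ b) :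
    |verticalIntegral f g k n| ≤ A * (2 * H * ((1 / 2) ^ α) ^ k) := by
  have l1 := (dyadic_lt_succ k n).le
  have l2 := (dyadic_lt_succ k (n + 1)).le
  refine (abs_integral_le_of_abs_le (hg.abs_dyadicMean_le h1 (l2.trans h2))
    (hg.abs_dyadicMean_le (h1.trans l1) h2) (hf.bound _ ⟨h1.trans l1, l2.trans h2⟩)).trans ?_
  exact mul_le_mul_of_nonneg_left (hg.abs_dyadicMean_succ_sub_le hα h1 h2) hA

/-- The absolute difference of the means of `g` over the two halves of `[t_{k,n}, t_{k,n+1}]`. -/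
noncomputable def oscillation (g : ℝ → ℝ) (k n : ℕ) : ℝ :=
  |dyadicMean g (k + 1) (2 * n) - dyadicMean g (k + 1) (2 * n + 1)|

/-- The integral of `f(t_{k+1,2n+1}, ·)` from the mean over `[t_{k,n}, t_{k,n+1}]` to the mean over
its right half. These are the terms that telescope in the difference of two successive levels. -/
noncomputable def halfIntegral (f : ℝ → ℝ → ℝ) (g : ℝ → ℝ) (k n : ℕ) : ℝ :=
  ∫ ξ in (dyadicMean g k n)..(dyadicMean g (k + 1) (2 * n + 1)), f (dyadic (k + 1) (2 * n + 1)) ξ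

lemma abs_integral_sub_le (hβ : 0 ≤ β) (hf : IsHolderIntegrand f β A B R a b) (hB : 0 ≤ B)
    {s t p q δ : ℝ} (hs : s ∈ Icc a b) (ht : t ∈ Icc a b) (hp : |p| ≤ R) (hq : |q| ≤ R)
    (hδ : |s - t| ≤ δ) :
    |(∫ ξ in p..q, f s ξ) - ∫ ξ in p..q, f t ξ| ≤ B * δ ^ β * |q - p| := by
  rw [← intervalIntegral.integral_sub ((hf.cont s hs).intervalIntegrable _ _)
    ((hf.cont t ht).intervalIntegrable _ _)]
  refine abs_integral_le_of_abs_le hp hq fun ξ hξ => (hf.holder s hs t ht ξ hξ).trans ?_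
  gcongr

lemma abs_dyadic_half_sub_left (k n : ℕ) :
    |dyadic k n - dyadic (k + 1) (2 * n + 1)| = (1 / 2) ^ (k + 1) := by
  rw [← dyadic_two_mul, abs_sub_comm, dyadic_succ_sub, abs_of_pos (by positivity)]

lemma abs_dyadic_half_sub_right (k n : ℕ) :
    |dyadic k (n + 1) - dyadic (k + 1) (2 * n + 1)| = (1 / 2) ^ (k + 1) := by
  rw [← dyadic_two_mul_add_two, dyadic_succ_sub, abs_of_pos (by positivity)]

lemma abs_halfIntegral_le (hg : IsHolderPath g α H R a b) (hα : 0 ≤ α)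
    (hf : IsHolderIntegrand f β A B R a b) (hA : 0 ≤ A) {k n : ℕ} (h1 : a ≤ dyadic k n)
    (h2 : dyadic k (n + 1) ≤ b) :
    |halfIntegral f g k n| ≤ A * (H * ((1 / 2) ^ α) ^ (k + 1)) := by
  have e1 := dyadic_two_mul k n
  have e2 := dyadic_two_mul_add_two k n
  have l1 := (dyadic_lt_succ (k + 1) (2 * n)).le
  have l2 := (dyadic_lt_succ (k + 1) (2 * n + 1)).le
  have h1' : a ≤ dyadic (k + 1) (2 * n) := e1 ▸ h1
  have h2' : dyadic (k + 1) (2 * n + 1 + 1) ≤ b := e2 ▸ h2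
  refine (abs_integral_le_of_abs_le (hg.abs_dyadicMean_le h1 h2)
    (hg.abs_dyadicMean_le (h1'.trans l1) h2')
    (hf.bound _ ⟨h1'.trans l1, l2.trans h2'⟩)).trans ?_
  refine mul_le_mul_of_nonneg_left ?_ hA
  have hcont : ContinuousOn g (Icc (dyadic k n) (dyadic k (n + 1))) :=
    hg.cont.mono (Icc_subset_Icc h1 h2)
  have := hg.abs_dyadicMean_succ_sub_le hα h1' h2'
  rw [dyadicMean_eq_avg hcont]
  rw [abs_le] at *
  constructor <;> linarith [this.1, this.2]

/-- Refining the curve on one vertical piece changes its integral by a telescoping term, up to an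
error controlled by the oscillations of `g`. -/
lemma abs_refine_vertical_le (hβ : 0 ≤ β) (hg : IsHolderPath g α H R a b)
    (hf : IsHolderIntegrand f β A B R a b) (hB : 0 ≤ B)
    {k n : ℕ} (h1 : a ≤ dyadic k n) (h2 : dyadic k (n + 2) ≤ b) :
    |verticalIntegral f g (k + 1) (2 * n + 1) + verticalIntegral f g (k + 1) (2 * n + 1 + 1)
        - verticalIntegral f g k n - (halfIntegral f g k (n + 1) - halfIntegral f g k n)|
      ≤ B * ((1 / 2) ^ (k + 1)) ^ β * ((oscillation g k n + oscillation g k (n + 1)) / 2) := by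
  have l1 := (dyadic_lt_succ k n).le
  have l2 := (dyadic_lt_succ k (n + 1)).le
  have m1 := (dyadic_lt_succ (k + 1) (2 * n)).le
  have m2 := (dyadic_lt_succ (k + 1) (2 * n + 1)).le
  have m3 := (dyadic_lt_succ (k + 1) (2 * (n + 1))).le
  have m4 := (dyadic_lt_succ (k + 1) (2 * (n + 1) + 1)).le
  have e1 := dyadic_two_mul k n
  have e2 := dyadic_two_mul_add_two k n
  have e3 := dyadic_two_mul k (n + 1)
  have e4 := dyadic_two_mul_add_two k (n + 1)
  have c1 := dyadicMean_eq_avg (hg.cont.mono (Icc_subset_Icc h1 (l2.trans h2)))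
  have c2 := dyadicMean_eq_avg (hg.cont.mono (Icc_subset_Icc (h1.trans l1) h2))
  have i1 := abs_dyadic_half_sub_right k n
  have i2 := abs_dyadic_half_sub_left k (n + 1)
  have eidx : 2 * n + 1 + 1 = 2 * (n + 1) := by ring
  unfold verticalIntegral halfIntegral oscillation
  rw [eidx] at m2 e2 ⊢
  have bM := hg.abs_dyadicMean_le h1 (l2.trans h2)
  have bM' := hg.abs_dyadicMean_le (h1.trans l1) h2
  have bQ := hg.abs_dyadicMean_le (k := k + 1) (n := 2 * n + 1) (by linarith)
    (by rw [eidx]; linarith)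
  have bP' := hg.abs_dyadicMean_le (k := k + 1) (n := 2 * (n + 1)) (by linarith) (by linarith)
  have ht : dyadic k (n + 1) ∈ Icc a b := ⟨by linarith, by linarith⟩
  have hs : dyadic (k + 1) (2 * n + 1) ∈ Icc a b := ⟨by linarith, by linarith⟩
  have hs' : dyadic (k + 1) (2 * (n + 1) + 1) ∈ Icc a b := ⟨by linarith, by linarith⟩
  have err1 := abs_integral_sub_le hβ hf hB ht hs bM bQ i1.le
  have err2 := abs_integral_sub_le hβ hf hB ht hs' bM' bP' i2.le
  rw [e3]
  set P := dyadicMean g (k + 1) (2 * n)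
  set Q := dyadicMean g (k + 1) (2 * n + 1)
  set P' := dyadicMean g (k + 1) (2 * (n + 1))
  set Q' := dyadicMean g (k + 1) (2 * (n + 1) + 1)
  set M := dyadicMean g k n
  set M' := dyadicMean g k (n + 1)
  set t := dyadic k (n + 1)
  set s := dyadic (k + 1) (2 * n + 1)
  set s' := dyadic (k + 1) (2 * (n + 1) + 1)
  have It : ∀ p q, IntervalIntegrable (f t) MeasureTheory.volume p q :=
    (hf.cont t ht).intervalIntegrable
  have Is' : ∀ p q, IntervalIntegrable (f s') MeasureTheory.volume p q :=
    (hf.cont s' hs').intervalIntegrable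
  have a1 := intervalIntegral.integral_add_adjacent_intervals (It M Q) (It Q P')
  have a2 := intervalIntegral.integral_add_adjacent_intervals (It M M') (It M' P')
  have a3 := intervalIntegral.integral_add_adjacent_intervals (Is' M' P') (Is' P' Q')
  have o1 : |Q - M| = |P - Q| / 2 := by
    rw [c1, ← abs_neg, show -(Q - (P + Q) / 2) = (P - Q) / 2 by ring, abs_div, abs_two]
  have o2 : |P' - M'| = |P' - Q'| / 2 := by
    rw [c2, show P' - (P' + Q') / 2 = (P' - Q') / 2 by ring, abs_div, abs_two]
  rw [o1] at err1
  rw [o2] at err2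
  rw [add_div, mul_add]
  rw [abs_le] at err1 err2 ⊢
  constructor <;> linarith [err1.1, err1.2, err2.1, err2.2]

end Level

/-! ### Existence, size and additivity of the integral -/

section Integral

lemma two_mul_ceil_bounds (a : ℝ) (ha : 0 ≤ a) (l : ℕ) :
    ⌈a * 2 ^ (l + 1)⌉₊ ≤ 2 * ⌈a * 2 ^ l⌉₊ ∧ 2 * ⌈a * 2 ^ l⌉₊ ≤ ⌈a * 2 ^ (l + 1)⌉₊ + 1 := by
  have e : a * 2 ^ (l + 1) = 2 * (a * 2 ^ l) := by ring
  rw [e]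
  have h0 : 0 ≤ a * 2 ^ l := by positivity
  generalize a * 2 ^ l = c at *
  constructor
  · rw [Nat.ceil_le]
    push_cast
    linarith [Nat.le_ceil c]
  · have h1 := Nat.ceil_lt_add_one h0
    have h2 := Nat.le_ceil (2 * c)
    have : ((2 * ⌈c⌉₊ : ℕ) : ℝ) < ((⌈2 * c⌉₊ + 2 : ℕ) : ℝ) := by
      push_cast
      linarith
    have := Nat.cast_lt.1 this
    omega

lemma two_mul_floor_bounds (b : ℝ) (hb : 0 ≤ b) (l : ℕ) :
    2 * ⌊b * 2 ^ l⌋₊ ≤ ⌊b * 2 ^ (l + 1)⌋₊ ∧ ⌊b * 2 ^ (l + 1)⌋₊ ≤ 2 * ⌊b * 2 ^ l⌋₊ + 1 := by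
  have e : b * 2 ^ (l + 1) = 2 * (b * 2 ^ l) := by ring
  rw [e]
  have h0 : 0 ≤ b * 2 ^ l := by positivity
  generalize b * 2 ^ l = c at *
  constructor
  · rw [Nat.le_floor_iff (by positivity)]
    push_cast
    linarith [Nat.floor_le h0]
  · have h1 := Nat.lt_floor_add_one c
    have h2 := Nat.floor_le (a := 2 * c) (by positivity)
    have : ((⌊2 * c⌋₊ : ℕ) : ℝ) < ((2 * ⌊c⌋₊ + 2 : ℕ) : ℝ) := by
      push_cast
      linarith
    have := Nat.cast_lt.1 this
    omega

lemma dyadic_bounds_of_mem_Ico {a b : ℝ} (hb : 0 ≤ b) {l n : ℕ}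
    (hn : n ∈ Finset.Ico (2 * ⌈a * 2 ^ l⌉₊) (2 * ⌊b * 2 ^ l⌋₊ - 1)) :
    a ≤ dyadic (l + 1) n ∧ dyadic (l + 1) (n + 2) ≤ b := by
  rw [Finset.mem_Ico] at hn
  constructor
  · refine le_trans ?_ (dyadic_mono _ hn.1)
    rw [dyadic_two_mul, le_dyadic_iff]
  · refine (dyadic_mono _ (show n + 2 ≤ 2 * ⌊b * 2 ^ l⌋₊ by omega)).trans ?_
    rw [dyadic_two_mul, dyadic_le_iff hb]

lemma abs_sum_Ico_sub_le {φ : ℕ → ℝ} {ε : ℝ} {p p' q' q N : ℕ} (hε : 0 ≤ ε)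
    (h1 : p ≤ p') (h2 : p' ≤ q') (h3 : q' ≤ q) (hφ : ∀ n ∈ Finset.Ico p q, |φ n| ≤ ε)
    (hN : (p' - p) + (q - q') ≤ N) :
    |∑ n ∈ Finset.Ico p q, φ n - ∑ n ∈ Finset.Ico p' q', φ n| ≤ N * ε := by
  have hsub : Finset.Ico p' q' ⊆ Finset.Ico p q := Finset.Ico_subset_Ico h1 h3
  rw [← Finset.sum_sdiff hsub, add_sub_cancel_right]
  refine (Finset.abs_sum_le_sum_abs _ _).trans ?_
  refine (Finset.sum_le_card_nsmul _ _ ε fun n hn => hφ n (Finset.mem_sdiff.1 hn).1).trans ?_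
  rw [nsmul_eq_mul, Finset.card_sdiff_of_subset hsub, Nat.card_Ico, Nat.card_Ico]
  gcongr
  omega

lemma sum_Ico_avg_le {o : ℕ → ℝ} (ho : ∀ n, 0 ≤ o n) (u v : ℕ) :
    ∑ n ∈ Finset.Ico u v, (o n + o (n + 1)) / 2 ≤ ∑ n ∈ Finset.Ico u (v + 1), o n := by
  have h1 : ∑ n ∈ Finset.Ico u v, o n ≤ ∑ n ∈ Finset.Ico u (v + 1), o n :=
    Finset.sum_le_sum_of_subset_of_nonneg (Finset.Ico_subset_Ico le_rfl (by omega))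
      fun n _ _ => ho n
  have h2 : ∑ n ∈ Finset.Ico u v, o (n + 1) ≤ ∑ n ∈ Finset.Ico u (v + 1), o n := by
    rw [Finset.sum_Ico_add' o u v 1]
    exact Finset.sum_le_sum_of_subset_of_nonneg (Finset.Ico_subset_Ico (by omega) le_rfl)
      fun n _ _ => ho n
  rw [← Finset.sum_div, Finset.sum_add_distrib]
  linarith

lemma abs_sum_double_sub_le {J' J G e : ℕ → ℝ} {u v : ℕ} (huv : u ≤ v)
    (h : ∀ n ∈ Finset.Ico u v,
      |J' (2 * n + 1) + J' (2 * n + 1 + 1) - J n - (G (n + 1) - G n)| ≤ e n) :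
    |∑ n ∈ Finset.Ico (2 * u + 1) (2 * v + 1), J' n - ∑ n ∈ Finset.Ico u v, J n - (G v - G u)|
      ≤ ∑ n ∈ Finset.Ico u v, e n := by
  induction v, huv using Nat.le_induction with
  | base => simp
  | succ v huv ih =>
    have ih := ih fun n hn => h n (Finset.Ico_subset_Ico le_rfl (Nat.le_succ v) hn)
    have hv := h v (Finset.mem_Ico.2 ⟨huv, Nat.lt_succ_self v⟩)
    rw [show 2 * (v + 1) + 1 = 2 * v + 1 + 1 + 1 by ring, Finset.sum_Ico_succ_top (by omega),
      Finset.sum_Ico_succ_top (by omega), Finset.sum_Ico_succ_top huv,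
      Finset.sum_Ico_succ_top huv]
    rw [abs_le] at *
    constructor <;> linarith [hv.1, hv.2, ih.1, ih.2]

variable {f : ℝ → ℝ → ℝ} {g : ℝ → ℝ} {α H R a b β A B : ℝ}

lemma muTerm_eq (g : ℝ → ℝ) (a b β : ℝ) (k : ℕ) :
    muTerm g a b β k = ((1 / 2) ^ (k + 1)) ^ β * levelVariation g a b k := by
  unfold muTerm
  congr 1
  rw [half_pow_rpow, one_div, Real.inv_rpow (by norm_num), ← Real.rpow_neg (by norm_num),
    ← Real.rpow_natCast, ← Real.rpow_mul (by norm_num)]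
  congr 1
  push_cast
  ring

lemma levelVariation_nonneg (g : ℝ → ℝ) (a b : ℝ) (k : ℕ) : 0 ≤ levelVariation g a b k :=
  Finset.sum_nonneg fun _ _ => abs_nonneg _

lemma muTerm_nonneg (g : ℝ → ℝ) (a b β : ℝ) (k : ℕ) : 0 ≤ muTerm g a b β k := by
  rw [muTerm_eq]
  exact mul_nonneg (by positivity) (levelVariation_nonneg _ _ _ _)

lemma sum_oscillation_le (hb0 : 0 ≤ b) (hb1 : b ≤ 1) (l : ℕ) :
    ∑ n ∈ Finset.Ico (2 * ⌈a * 2 ^ l⌉₊) (2 * ⌊b * 2 ^ l⌋₊), oscillation g (l + 1) n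
      ≤ levelVariation g a b (l + 1) := by
  unfold levelVariation oscillation
  refine Finset.sum_le_sum_of_subset_of_nonneg (fun n hn => ?_) fun _ _ _ => abs_nonneg _
  rw [Finset.mem_Ico] at hn
  have h1 : a ≤ dyadic (l + 1) n := by
    refine le_trans ?_ (dyadic_mono _ hn.1)
    rw [dyadic_two_mul, le_dyadic_iff]
  have h2 : dyadic (l + 1) (n + 1) ≤ b := by
    refine (dyadic_mono _ (show n + 1 ≤ 2 * ⌊b * 2 ^ l⌋₊ by omega)).trans ?_
    rw [dyadic_two_mul, dyadic_le_iff hb0]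
  simp only [Finset.mem_filter, Finset.mem_range]
  refine ⟨?_, h1, h2⟩
  have h3 := h2.trans hb1
  unfold dyadic at h3
  rw [div_le_one (by positivity)] at h3
  exact_mod_cast h3

/-- The line integrals along the step curves of two successive levels differ by a bounded number of
boundary terms and by a term of the series `μ`. -/
lemma abs_lineIntegral_succ_sub_le (ha : 0 ≤ a) (hb0 : 0 ≤ b) (hb1 : b ≤ 1)
    (hα : 0 ≤ α) (hβ : 0 ≤ β) (hg : IsHolderPath g α H R a b)
    (hf : IsHolderIntegrand f β A B R a b) (hA : 0 ≤ A) (hB : 0 ≤ B) (l : ℕ) :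
    |lineIntegral f g a b (l + 2) - lineIntegral f g a b (l + 1)|
      ≤ 12 * (A * (H * ((1 / 2) ^ α) ^ (l + 2))) + B * muTerm g a b β (l + 1) := by
  rw [lineIntegral_succ hb0 hb1, lineIntegral_succ hb0 hb1]
  obtain ⟨c1, c2⟩ := two_mul_ceil_bounds a ha l
  obtain ⟨f1, f2⟩ := two_mul_floor_bounds b hb0 l
  have hε : 0 ≤ A * (2 * H * ((1 / 2 : ℝ) ^ α) ^ (l + 2)) := by
    have := hg.nonneg
    positivity
  have hmu := muTerm_nonneg g a b β (l + 1)
  have hBmu := mul_nonneg hB hmu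
  have hJ : ∀ n ∈ Finset.Ico (2 * ⌈a * 2 ^ (l + 1)⌉₊) (2 * ⌊b * 2 ^ (l + 1)⌋₊ - 1),
      |verticalIntegral f g (l + 2) n| ≤ A * (2 * H * ((1 / 2) ^ α) ^ (l + 2)) := fun n hn =>
    abs_verticalIntegral_le hg hα hf hA (dyadic_bounds_of_mem_Ico hb0 hn).1
      (dyadic_bounds_of_mem_Ico hb0 hn).2
  rcases lt_or_ge ⌈a * 2 ^ l⌉₊ ⌊b * 2 ^ l⌋₊ with hlt | hge
  · -- The refinement of the pieces of level `l + 1` leaves at most five pieces of level `l + 2` over.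
    have hosc := sum_oscillation_le (g := g) (a := a) hb0 hb1 l
    have hG1 : |halfIntegral f g (l + 1) (2 * ⌈a * 2 ^ l⌉₊)|
        ≤ A * (H * ((1 / 2) ^ α) ^ (l + 2)) := by
      have := dyadic_bounds_of_mem_Ico (a := a) (b := b) (l := l) hb0
        (Finset.mem_Ico.2 ⟨le_rfl, by omega⟩ :
          2 * ⌈a * 2 ^ l⌉₊ ∈ Finset.Ico (2 * ⌈a * 2 ^ l⌉₊) (2 * ⌊b * 2 ^ l⌋₊ - 1))
      exact abs_halfIntegral_le hg hα hf hA this.1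
        ((dyadic_mono _ (by omega)).trans this.2)
    have hG2 : |halfIntegral f g (l + 1) (2 * ⌊b * 2 ^ l⌋₊ - 1)|
        ≤ A * (H * ((1 / 2) ^ α) ^ (l + 2)) := by
      obtain ⟨n, hn⟩ : ∃ n, 2 * ⌊b * 2 ^ l⌋₊ - 1 = n + 1 := ⟨2 * ⌊b * 2 ^ l⌋₊ - 2, by omega⟩
      have := dyadic_bounds_of_mem_Ico (a := a) (b := b) (l := l) (n := n) hb0
        (Finset.mem_Ico.2 ⟨by omega, by omega⟩)
      rw [hn]
      exact abs_halfIntegral_le hg hα hf hA (this.1.trans (dyadic_mono _ (by omega))) this.2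
    have huv : 2 * ⌈a * 2 ^ l⌉₊ ≤ 2 * ⌊b * 2 ^ l⌋₊ - 1 := by omega
    have hmid := abs_sum_double_sub_le (J' := verticalIntegral f g (l + 2))
      (J := verticalIntegral f g (l + 1)) (G := halfIntegral f g (l + 1)) huv
      fun n hn => abs_refine_vertical_le hβ hg hf hB (dyadic_bounds_of_mem_Ico hb0 hn).1
        (dyadic_bounds_of_mem_Ico hb0 hn).2
    rw [← Finset.mul_sum] at hmid
    have hav := sum_Ico_avg_le (o := oscillation g (l + 1)) (fun n => abs_nonneg _)
      (2 * ⌈a * 2 ^ l⌉₊) (2 * ⌊b * 2 ^ l⌋₊ - 1)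
    rw [show 2 * ⌊b * 2 ^ l⌋₊ - 1 + 1 = 2 * ⌊b * 2 ^ l⌋₊ by omega] at hav
    have hmid2 := hmid.trans (mul_le_mul_of_nonneg_left (hav.trans hosc) (by positivity))
    rw [mul_assoc B, ← muTerm_eq] at hmid2
    have hbd := abs_sum_Ico_sub_le (N := 5) hε
      (p' := 2 * (2 * ⌈a * 2 ^ l⌉₊) + 1) (q' := 2 * (2 * ⌊b * 2 ^ l⌋₊ - 1) + 1)
      (by omega) (by omega) (by omega) hJ (by omega)
    push_cast at hbd
    rw [abs_le] at *
    constructor <;> linarith [hbd.1, hbd.2, hmid2.1, hmid2.2, hG1.1, hG1.2, hG2.1, hG2.2]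
  · -- No dyadic interval of level `l` fits into `[a, b]`, and at most three pieces occur one level on.
    rw [Finset.Ico_eq_empty (a := 2 * ⌈a * 2 ^ l⌉₊) (by omega), Finset.sum_empty, sub_zero]
    refine (Finset.abs_sum_le_sum_abs _ _).trans ?_
    refine (Finset.sum_le_card_nsmul _ _ _ hJ).trans ?_
    rw [nsmul_eq_mul, Nat.card_Ico]
    have : (((2 * ⌊b * 2 ^ (l + 1)⌋₊ - 1) - 2 * ⌈a * 2 ^ (l + 1)⌉₊ : ℕ) : ℝ) ≤ 3 := by
      exact_mod_cast (show (2 * ⌊b * 2 ^ (l + 1)⌋₊ - 1) - 2 * ⌈a * 2 ^ (l + 1)⌉₊ ≤ 3 by omega)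
    have h3 := mul_le_mul_of_nonneg_right this hε
    linarith

/-- At the level that matches the length of `[a, b]` at most one vertical piece occurs. -/
lemma abs_lineIntegral_first_le (hb0 : 0 ≤ b) (hb1 : b ≤ 1) (hα : 0 ≤ α)
    (hg : IsHolderPath g α H R a b) (hf : IsHolderIntegrand f β A B R a b) (hA : 0 ≤ A) {l : ℕ}
    (hl : b - a ≤ (1 / 2) ^ l) :
    |lineIntegral f g a b (l + 1)| ≤ A * (2 * H * ((1 / 2) ^ α) ^ (l + 1)) := by
  rw [lineIntegral_succ hb0 hb1]
  have hε : 0 ≤ A * (2 * H * ((1 / 2 : ℝ) ^ α) ^ (l + 1)) := by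
    have := hg.nonneg
    positivity
  refine (Finset.abs_sum_le_sum_abs _ _).trans ?_
  refine (Finset.sum_le_card_nsmul _ _ _ fun n hn =>
    abs_verticalIntegral_le hg hα hf hA (dyadic_bounds_of_mem_Ico hb0 hn).1
      (dyadic_bounds_of_mem_Ico hb0 hn).2).trans ?_
  rw [nsmul_eq_mul, Nat.card_Ico]
  have h1 : (⌊b * 2 ^ l⌋₊ : ℝ) ≤ ⌈a * 2 ^ l⌉₊ + 1 := by
    have e1 := Nat.floor_le (a := b * 2 ^ l) (by positivity)
    have e2 := Nat.le_ceil (a * 2 ^ l)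
    have e3 : (b - a) * 2 ^ l ≤ 1 := by
      have := mul_le_mul_of_nonneg_right hl (by positivity : (0 : ℝ) ≤ 2 ^ l)
      rwa [← mul_pow, one_div, inv_mul_cancel₀ (by norm_num), one_pow] at this
    linarith
  have h2 : ⌊b * 2 ^ l⌋₊ ≤ ⌈a * 2 ^ l⌉₊ + 1 := by exact_mod_cast h1
  have : (((2 * ⌊b * 2 ^ l⌋₊ - 1) - 2 * ⌈a * 2 ^ l⌉₊ : ℕ) : ℝ) ≤ 1 := by
    exact_mod_cast (show (2 * ⌊b * 2 ^ l⌋₊ - 1) - 2 * ⌈a * 2 ^ l⌉₊ ≤ 1 by omega)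
  simpa using mul_le_mul_of_nonneg_right this hε

/-- Existence of the integral, with its size: the first term comes from the coarsest level and from
the ends of the interval, the second one from the oscillation of the integrator on finer scales. -/
lemma exists_hasIntegral (ha : 0 ≤ a) (hab : a < b) (hb1 : b ≤ 1)
    (hα : 0 < α) (hβ : 0 ≤ β) (hg : IsHolderPath g α H R a b)
    (hf : IsHolderIntegrand f β A B R a b) (hA : 0 ≤ A) (hB : 0 ≤ B) {V : ℝ}
    (hV : ∀ k₀ : ℕ, 1 / 2 ^ (k₀ + 1) ≤ b - a → b - a ≤ 2 / 2 ^ k₀ →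
      Summable (fun i : ℕ => muTerm g a b β (k₀ + 1 + i)) ∧
      ∑' i : ℕ, muTerm g a b β (k₀ + 1 + i) ≤ V) :
    ∃ I, HasIntegral f g a b I ∧
      |I| ≤ (2 + 12 / (1 - (1 / 2) ^ α)) * H * (A * (b - a) ^ α) + B * V := by
  obtain ⟨l, hl1, hl2⟩ := exists_nat_pow_near_of_lt_one (sub_pos.2 hab) (by linarith)
    (by norm_num : (0 : ℝ) < 1 / 2) (by norm_num)
  have hb0 : 0 ≤ b := ha.trans hab.le
  have hpos : (0 : ℝ) < 2 ^ l := by positivity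
  obtain ⟨hsum, hV⟩ := hV l (by rw [← one_div_pow]; exact hl1.le)
    (hl2.trans (by rw [one_div_pow]; gcongr; norm_num))
  set r : ℝ := (1 / 2) ^ α with hr
  have hr0 : 0 ≤ r := by positivity
  have hr1 : r < 1 := Real.rpow_lt_one (by norm_num) (by norm_num) hα
  have hrl : r ^ (l + 1) ≤ (b - a) ^ α := by
    rw [hr, ← half_pow_rpow]
    exact Real.rpow_le_rpow (by positivity) hl1.le hα.le
  set u : ℕ → ℝ := fun i => lineIntegral f g a b (l + 1 + i) with hu
  set e : ℕ → ℝ := fun i => 12 * (A * (H * r ^ (l + 2))) * r ^ i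
    + B * muTerm g a b β (l + 1 + i) with he
  have hue : ∀ i, dist (u i) (u (i + 1)) ≤ e i := by
    intro i
    have := abs_lineIntegral_succ_sub_le ha hb0 hb1 hα.le hβ hg hf hA hB (l + i)
    rw [dist_comm, Real.dist_eq]
    simp only [hu, he]
    rw [show l + 1 + (i + 1) = l + i + 2 by ring, show l + 1 + i = l + i + 1 by ring]
    refine this.trans (le_of_eq ?_)
    ring
  have hgeo := hasSum_geometric_of_lt_one hr0 hr1
  have hes : HasSum e (12 * (A * (H * r ^ (l + 2))) * (1 - r)⁻¹
      + B * ∑' i : ℕ, muTerm g a b β (l + 1 + i)) :=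
    (hgeo.mul_left _).add (hsum.hasSum.mul_left B)
  obtain ⟨I, hI⟩ := cauchySeq_tendsto_of_complete
    (cauchySeq_of_dist_le_of_summable e hue hes.summable)
  have hdist := dist_le_tsum_of_dist_le_of_tendsto₀ e hue hes.summable hI
  rw [hes.tsum_eq] at hdist
  refine ⟨I, ?_, ?_⟩
  · have : Tendsto (fun i => lineIntegral f g a b (i + (l + 1))) atTop (𝓝 I) := by
      simpa only [hu, add_comm] using hI
    exact (tendsto_add_atTop_iff_nat (l + 1)).1 this
  · have h0 := abs_lineIntegral_first_le hb0 hb1 hα.le hg hf hA hl2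
    have hAH : 0 ≤ A * H := mul_nonneg hA hg.nonneg
    have hinv : 0 ≤ (1 - r)⁻¹ := inv_nonneg.2 (by linarith)
    have h1 : |I| ≤ |u 0| + dist (u 0) I := by
      rw [Real.dist_eq]
      have := abs_sub_abs_le_abs_sub I (u 0)
      rw [abs_sub_comm] at this
      linarith
    have h2 : A * (2 * H * r ^ (l + 1)) ≤ 2 * (A * H) * (b - a) ^ α := by
      calc A * (2 * H * r ^ (l + 1)) = 2 * (A * H) * r ^ (l + 1) := by ring
        _ ≤ _ := by gcongr
    have h3 : 12 * (A * (H * r ^ (l + 2))) * (1 - r)⁻¹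
        ≤ 12 * (A * H) * (1 - r)⁻¹ * (b - a) ^ α := by
      have : r ^ (l + 2) ≤ (b - a) ^ α := (pow_le_pow_of_le_one hr0 hr1.le (by omega)).trans hrl
      calc 12 * (A * (H * r ^ (l + 2))) * (1 - r)⁻¹
          = 12 * (A * H) * (1 - r)⁻¹ * r ^ (l + 2) := by ring
        _ ≤ _ := by gcongr
    have h4 : B * ∑' i : ℕ, muTerm g a b β (l + 1 + i) ≤ B * V := by gcongr
    have h5 : |u 0| ≤ A * (2 * H * r ^ (l + 1)) := h0
    calc |I| ≤ 2 * (A * H) * (b - a) ^ α + (12 * (A * H) * (1 - r)⁻¹ * (b - a) ^ α + B * V) := by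
          linarith
      _ = _ := by rw [div_eq_mul_inv]; ring

lemma hasIntegral_self (f : ℝ → ℝ → ℝ) (g : ℝ → ℝ) (ha0 : 0 ≤ a) (ha1 : a ≤ 1) :
    HasIntegral f g a a 0 := by
  refine tendsto_const_nhds.congr' ?_
  filter_upwards [eventually_ge_atTop 1] with k hk
  obtain ⟨l, rfl⟩ : ∃ l, k = l + 1 := ⟨k - 1, by omega⟩
  rw [lineIntegral_succ ha0 ha1, Finset.Ico_eq_empty, Finset.sum_empty]
  have := (Nat.floor_le_ceil (a * 2 ^ l))
  omega

/-- Additivity of the integral over adjacent intervals. It holds only in the limit: at each level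
up to three vertical pieces near the common endpoint are missing in the two parts. -/
lemma HasIntegral.sub_left {s t I₁ I₂ : ℝ} (hs0 : 0 ≤ s) (hst : s ≤ t) (ht1 : t ≤ 1)
    (hα : 0 < α) (hg : IsHolderPath g α H R 0 t) (hf : IsHolderIntegrand f β A B R 0 t)
    (hA : 0 ≤ A) (h1 : HasIntegral f g 0 s I₁) (h2 : HasIntegral f g 0 t I₂) :
    HasIntegral f g s t (I₂ - I₁) := by
  have hr0 : 0 ≤ (1 / 2 : ℝ) ^ α := by positivity
  have hr1 : (1 / 2 : ℝ) ^ α < 1 := Real.rpow_lt_one (by norm_num) (by norm_num) hα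
  have hlim : Tendsto (fun k => 3 * (A * (2 * H * ((1 / 2 : ℝ) ^ α) ^ k))) atTop (𝓝 0) := by
    have := (((tendsto_pow_atTop_nhds_zero_of_lt_one hr0 hr1).const_mul (2 * H)).const_mul
      A).const_mul 3
    simpa using this
  have key : Tendsto (fun k => lineIntegral f g 0 t k - lineIntegral f g 0 s k
      - lineIntegral f g s t k) atTop (𝓝 0) := by
    refine squeeze_zero_norm' ?_ hlim
    filter_upwards [eventually_ge_atTop 1] with k hk
    obtain ⟨l, rfl⟩ : ∃ l, k = l + 1 := ⟨k - 1, by omega⟩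
    have ht0 := hs0.trans hst
    have hε : 0 ≤ A * (2 * H * ((1 / 2 : ℝ) ^ α) ^ (l + 1)) := by
      have := hg.nonneg
      positivity
    rw [lineIntegral_succ ht0 ht1, lineIntegral_succ hs0 (hst.trans ht1),
      lineIntegral_succ ht0 ht1, Real.norm_eq_abs]
    have hJ : ∀ n ∈ Finset.Ico (2 * ⌈(0 : ℝ) * 2 ^ l⌉₊) (2 * ⌊t * 2 ^ l⌋₊ - 1),
        |verticalIntegral f g (l + 1) n| ≤ A * (2 * H * ((1 / 2) ^ α) ^ (l + 1)) := fun n hn =>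
      abs_verticalIntegral_le hg hα.le hf hA (dyadic_bounds_of_mem_Ico ht0 hn).1
        (dyadic_bounds_of_mem_Ico ht0 hn).2
    rw [zero_mul, Nat.ceil_zero, mul_zero] at *
    have c1 := Nat.floor_le_ceil (s * 2 ^ l)
    have c2 := Nat.ceil_le_floor_add_one (s * 2 ^ l)
    have c3 : ⌊s * 2 ^ l⌋₊ ≤ ⌊t * 2 ^ l⌋₊ := Nat.floor_le_floor (by gcongr)
    generalize ⌈s * 2 ^ l⌉₊ = p at *
    generalize ⌊s * 2 ^ l⌋₊ = q at *
    generalize ⌊t * 2 ^ l⌋₊ = w at *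
    rcases le_or_gt (2 * p) (2 * w - 1) with h | h
    · rw [← Finset.sum_Ico_consecutive _ (Nat.zero_le (2 * q - 1)) (by omega : _ ≤ 2 * w - 1),
        ← Finset.sum_Ico_consecutive _ (by omega : 2 * q - 1 ≤ 2 * p) h]
      rw [show ∀ x y z : ℝ, x + (y + z) - x - z = y by intros; ring]
      refine (Finset.abs_sum_le_sum_abs _ _).trans ?_
      refine (Finset.sum_le_card_nsmul _ _ _ fun n hn => hJ n ?_).trans ?_
      · rw [Finset.mem_Ico] at *
        omega
      rw [nsmul_eq_mul, Nat.card_Ico]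
      refine mul_le_mul_of_nonneg_right ?_ hε
      exact_mod_cast (show 2 * p - (2 * q - 1) ≤ 3 by omega)
    · rw [Finset.Ico_eq_empty (a := 2 * p) (by omega), Finset.sum_empty, sub_zero]
      rw [← Finset.sum_Ico_consecutive _ (Nat.zero_le (2 * q - 1)) (by omega : _ ≤ 2 * w - 1),
        add_sub_cancel_left]
      refine (Finset.abs_sum_le_sum_abs _ _).trans ?_
      refine (Finset.sum_le_card_nsmul _ _ _ fun n hn => hJ n ?_).trans ?_
      · rw [Finset.mem_Ico] at *
        omega
      rw [nsmul_eq_mul, Nat.card_Ico]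
      refine mul_le_mul_of_nonneg_right ?_ hε
      exact_mod_cast (show 2 * w - 1 - (2 * q - 1) ≤ 3 by omega)
  have := (h2.sub h1).sub key
  rw [sub_zero] at this
  refine this.congr fun k => ?_
  ring

lemma HasIntegral.sub_integrand {f₁ f₂ : ℝ → ℝ → ℝ} {I₁ I₂ : ℝ}
    (hb0 : 0 ≤ b) (hb1 : b ≤ 1) (hc₁ : ∀ t ∈ Icc a b, Continuous (f₁ t))
    (hc₂ : ∀ t ∈ Icc a b, Continuous (f₂ t)) (h₁ : HasIntegral f₁ g a b I₁)
    (h₂ : HasIntegral f₂ g a b I₂) :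
    HasIntegral (fun t ξ => f₁ t ξ - f₂ t ξ) g a b (I₁ - I₂) := by
  refine (h₁.sub h₂).congr' ?_
  filter_upwards [eventually_ge_atTop 1] with k hk
  obtain ⟨l, rfl⟩ : ∃ l, k = l + 1 := ⟨k - 1, by omega⟩
  simp only [lineIntegral_succ hb0 hb1]
  rw [← Finset.sum_sub_distrib]
  refine Finset.sum_congr rfl fun n hn => ?_
  obtain ⟨h1, h2⟩ := dyadic_bounds_of_mem_Ico hb0 hn
  have ht : dyadic (l + 1) (n + 1) ∈ Icc a b :=
    ⟨h1.trans (dyadic_mono _ (by omega)), (dyadic_mono _ (by omega)).trans h2⟩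
  exact (intervalIntegral.integral_sub ((hc₁ _ ht).intervalIntegrable _ _)
    ((hc₂ _ ht).intervalIntegrable _ _)).symm

end Integral

/-! ### Fixed points in weighted Hölder norms -/

section FixedPoint

variable {E : Type*} [NormedAddCommGroup E]

/-- `y` starts at `y₀` and is `β`-Hölder on `[0, T]` with constant `M`. -/
structure IsHolderFrom (β T M : ℝ) (y₀ : E) (y : ℝ → E) : Prop where
  initial : y 0 = y₀
  holder : ∀ s ∈ Icc 0 T, ∀ t ∈ Icc 0 T, ‖y s - y t‖ ≤ M * |s - t| ^ β

/-- A weighted local Hölder bound: on time intervals of length at most `τ` the `β`-Hölder constant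
of `w` is at most `N e^{t/τ}`, where `t` is the right endpoint. The exponential weight makes the
supremum of `w` small compared with `N` on all of `[0, T]` if `τ` is small; see
`WeightedHolder.norm_le`. -/
def WeightedHolder (β T τ N : ℝ) (w : ℝ → E) : Prop :=
  ∀ s t, 0 ≤ s → s ≤ t → t ≤ T → t - s ≤ τ →
    ‖w t - w s‖ ≤ N * Real.exp (t / τ) * (t - s) ^ β

variable {β T τ N M ρ : ℝ} {w y z : ℝ → E} {y₀ : E}

lemma WeightedHolder.norm_le (hβ : 0 < β) (hτ : 0 < τ) (hN : 0 ≤ N) (hw : WeightedHolder β T τ N w)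
    (h0 : w 0 = 0) {t : ℝ} (ht : t ∈ Icc 0 T) :
    ‖w t‖ ≤ 2 * τ ^ β * (N * Real.exp (t / τ)) := by
  have key : ∀ n : ℕ, ∀ t ∈ Icc 0 T, t ≤ n * τ → ‖w t‖ ≤ 2 * τ ^ β * (N * Real.exp (t / τ)) := by
    intro n
    induction n with
    | zero =>
      intro t ht htn
      have : t = 0 := le_antisymm (by simpa using htn) ht.1
      rw [this, h0, norm_zero]
      positivity
    | succ n ih =>
      intro t ht htn
      rcases le_or_gt t τ with h | h
      · have h1 := hw 0 t le_rfl ht.1 ht.2 (by simpa using h)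
        rw [h0, sub_zero, sub_zero] at h1
        have h2 : t ^ β ≤ τ ^ β := Real.rpow_le_rpow ht.1 h hβ.le
        have h3 : 0 ≤ N * Real.exp (t / τ) := by positivity
        have h4 : 0 ≤ τ ^ β := by positivity
        nlinarith [mul_le_mul_of_nonneg_left h2 h3, mul_nonneg h3 h4]
      · have h1 := hw (t - τ) t (by linarith) (by linarith) ht.2 (by linarith)
        rw [sub_sub_cancel] at h1
        push_cast at htn
        have h2 := ih (t - τ) ⟨by linarith, by linarith [ht.2]⟩ (by linarith)
        -- One time step costs a factor `e ≥ 2`, so the geometric series of steps sums to `2`.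
        have he : 2 * Real.exp ((t - τ) / τ) ≤ Real.exp (t / τ) := by
          have : t / τ = (t - τ) / τ + 1 := by field_simp; ring
          rw [this, Real.exp_add]
          nlinarith [Real.add_one_le_exp (1 : ℝ), Real.exp_pos ((t - τ) / τ)]
        have h3 : ‖w t‖ ≤ ‖w t - w (t - τ)‖ + ‖w (t - τ)‖ := by
          simpa using norm_add_le (w t - w (t - τ)) (w (t - τ))
        have h4 : 0 ≤ τ ^ β * N := by positivity
        nlinarith [mul_le_mul_of_nonneg_left he h4]
  obtain ⟨n, hn⟩ := exists_nat_ge (t / τ)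
  exact key n t ht (by rwa [div_le_iff₀ hτ] at hn)

lemma exp_div_le (hτ : 0 < τ) {s t : ℝ} (h : s ≤ t) : Real.exp (s / τ) ≤ Real.exp (t / τ) :=
  Real.exp_le_exp.2 (by gcongr)

lemma WeightedHolder.const_sub (h : WeightedHolder β T τ N w) (c : E) :
    WeightedHolder β T τ N (fun t => w t - c) := by
  intro s t h1 h2 h3 h4
  simpa using h s t h1 h2 h3 h4

lemma WeightedHolder.isHolderFrom (hβ : 0 < β) (hτ : 0 < τ) (hN : 0 ≤ N)
    (hw : WeightedHolder β T τ N y) (h0 : y 0 = y₀) :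
    IsHolderFrom β T (4 * (N * Real.exp (T / τ))) y₀ y := by
  refine ⟨h0, ?_⟩
  have main : ∀ s t, 0 ≤ s → s ≤ t → t ≤ T →
      ‖y s - y t‖ ≤ 4 * (N * Real.exp (T / τ)) * (t - s) ^ β := by
    intro s t hs hst ht
    have hpos : 0 ≤ (t - s) ^ β := Real.rpow_nonneg (by linarith) _
    have hNe : 0 ≤ N * Real.exp (T / τ) := by positivity
    rcases le_or_gt (t - s) τ with h | h
    · rw [norm_sub_rev]
      refine (hw s t hs hst ht h).trans ?_
      have := mul_le_mul_of_nonneg_left (exp_div_le hτ ht) hN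
      exact mul_le_mul_of_nonneg_right (by linarith) hpos
    · have h1 := (hw.const_sub y₀).norm_le hβ hτ hN (by simp [h0]) (t := s) ⟨hs, hst.trans ht⟩
      have h2 := (hw.const_sub y₀).norm_le hβ hτ hN (by simp [h0]) (t := t) ⟨hs.trans hst, ht⟩
      have e1 := mul_le_mul_of_nonneg_left (exp_div_le hτ (hst.trans ht)) hN
      have e2 := mul_le_mul_of_nonneg_left (exp_div_le hτ ht) hN
      have h3 : ‖y s - y t‖ ≤ ‖y s - y₀‖ + ‖y t - y₀‖ := by
        have := norm_sub_le (y s - y₀) (y t - y₀)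
        rwa [sub_sub_sub_cancel_right] at this
      have h4 : τ ^ β ≤ (t - s) ^ β := Real.rpow_le_rpow hτ.le h.le hβ.le
      have h5 : 0 ≤ 2 * τ ^ β := by positivity
      have e3 := mul_le_mul_of_nonneg_left e1 h5
      have e4 := mul_le_mul_of_nonneg_left e2 h5
      nlinarith [mul_le_mul_of_nonneg_right h4 hNe]
  intro s hs t ht
  rcases le_total s t with h | h
  · rw [abs_sub_comm, abs_of_nonneg (by linarith)]
    exact main s t hs.1 h ht.2
  · rw [norm_sub_rev, abs_of_nonneg (by linarith)]
    exact main t s ht.1 h hs.2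

lemma IsHolderFrom.mono {M' : ℝ} (hM : M ≤ M') (hy : IsHolderFrom β T M y₀ y) :
    IsHolderFrom β T M' y₀ y :=
  ⟨hy.initial, fun s hs t ht => (hy.holder s hs t ht).trans (by gcongr)⟩

lemma IsHolderFrom.weightedHolder_sub (hτ : 0 < τ) (hM : 0 ≤ M) (hy : IsHolderFrom β T M y₀ y)
    (hz : IsHolderFrom β T M y₀ z) : WeightedHolder β T τ (2 * M) (fun t => y t - z t) := by
  intro s t hs hst ht _
  have h1 := hy.holder t ⟨hs.trans hst, ht⟩ s ⟨hs, hst.trans ht⟩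
  have h2 := hz.holder t ⟨hs.trans hst, ht⟩ s ⟨hs, hst.trans ht⟩
  rw [abs_of_nonneg (by linarith)] at h1 h2
  have hpos : 0 ≤ (t - s) ^ β := Real.rpow_nonneg (by linarith) _
  have h3 : ‖y t - z t - (y s - z s)‖ ≤ ‖y t - y s‖ + ‖z t - z s‖ := by
    rw [show y t - z t - (y s - z s) = (y t - y s) - (z t - z s) by abel]
    exact norm_sub_le _ _
  have he : 1 ≤ Real.exp (t / τ) := Real.one_le_exp (div_nonneg (hs.trans hst) hτ.le)
  have h4 : 0 ≤ 2 * M * (t - s) ^ β := by positivity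
  nlinarith [mul_le_mul_of_nonneg_left he h4]

lemma WeightedHolder.bound_on_Icc (hβ : 0 < β) (hτ : 0 < τ) (hN : 0 ≤ N)
    (hw : WeightedHolder β T τ N w) (h0 : w 0 = 0) {s t : ℝ} (hs : 0 ≤ s) (ht : t ≤ T)
    (hst : t - s ≤ τ) :
    (∀ u ∈ Icc s t, ‖w u‖ ≤ 2 * τ ^ β * (N * Real.exp (t / τ))) ∧
    (∀ u ∈ Icc s t, ∀ v ∈ Icc s t, ‖w u - w v‖ ≤ N * Real.exp (t / τ) * |u - v| ^ β) := by
  constructor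
  · intro u hu
    refine (hw.norm_le hβ hτ hN h0 ⟨hs.trans hu.1, hu.2.trans ht⟩).trans ?_
    have := exp_div_le hτ hu.2
    gcongr
  · have main : ∀ u v, s ≤ u → u ≤ v → v ≤ t →
        ‖w v - w u‖ ≤ N * Real.exp (t / τ) * |v - u| ^ β := by
      intro u v hu huv hv
      refine (hw u v (hs.trans hu) huv (hv.trans ht) (by linarith)).trans ?_
      have := exp_div_le hτ hv
      rw [abs_of_nonneg (by linarith)]
      have hpos : 0 ≤ (v - u) ^ β := Real.rpow_nonneg (by linarith) _
      gcongr
    intro u hu v hv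
    rcases le_total u v with h | h
    · rw [norm_sub_rev, abs_sub_comm]
      exact main u v hu.1 h hv.2
    · exact main v u hv.1 h hu.2

/-- The step size. The factor `τ ^ β` comes from the supremum bound `WeightedHolder.norm_le`, the
factor `τ ^ (ρ - β)` from the part of the integral estimate of order `ρ > β`. -/
lemma exists_small_step (hβ : 0 < β) (hρ : β < ρ) (c : ℝ) :
    ∃ τ : ℝ, 0 < τ ∧ τ ≤ 1 ∧ c * (2 * τ ^ β + 3 * τ ^ (ρ - β)) ≤ 1 / 2 := by
  have h1 : Tendsto (fun τ : ℝ => c * (2 * τ ^ β + 3 * τ ^ (ρ - β))) (𝓝 0) (𝓝 0) := by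
    have e1 := (Real.continuousAt_rpow_const 0 β (Or.inr hβ.le)).tendsto
    have e2 := (Real.continuousAt_rpow_const 0 (ρ - β) (Or.inr (by linarith))).tendsto
    rw [Real.zero_rpow hβ.ne'] at e1
    rw [Real.zero_rpow (by linarith)] at e2
    simpa using ((e1.const_mul 2).add (e2.const_mul 3)).const_mul c
  have h2 : ∀ᶠ τ : ℝ in 𝓝[>] 0, c * (2 * τ ^ β + 3 * τ ^ (ρ - β)) < 1 / 2 :=
    (h1.mono_left nhdsWithin_le_nhds).eventually_lt_const (by norm_num)
  have h3 : ∀ᶠ τ : ℝ in 𝓝[>] 0, τ ∈ Ioc (0 : ℝ) 1 := Ioc_mem_nhdsGT one_pos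
  obtain ⟨τ, hτ, h⟩ := (h2.and h3).exists
  exact ⟨τ, h.1, h.2, hτ.le⟩

lemma rpow_sub_le_step (hτ1 : τ ≤ 1) (hρ : β < ρ) {r : ℝ} (hr : 0 < r) (hrτ : r ≤ τ) :
    r ^ ρ ≤ r ^ β * τ ^ (ρ - β) ∧ r ^ ρ ≤ r ^ β := by
  have h : r ^ ρ = r ^ β * r ^ (ρ - β) := by
    rw [← Real.rpow_add hr]
    congr 1
    ring
  constructor
  · rw [h]
    gcongr
  · exact Real.rpow_le_rpow_of_exponent_ge hr (hrτ.trans hτ1) hρ.le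

/-- The growth estimate for the map `Φ` of the integral equation. -/
def HasGrowthBound (β ρ T : ℝ) (y₀ : E) (Φ : (ℝ → E) → ℝ → E) (c : ℝ) : Prop :=
  ∀ M y, IsHolderFrom β T M y₀ y → ∀ s t Y L, 0 ≤ s → s < t → t ≤ T → 0 ≤ Y → 0 ≤ L →
    (∀ u ∈ Icc s t, ‖y u‖ ≤ Y) →
    (∀ u ∈ Icc s t, ∀ v ∈ Icc s t, ‖y u - y v‖ ≤ L * |u - v| ^ β) →
    ‖Φ y t - Φ y s‖ ≤ c * ((1 + Y) * (t - s) ^ β + (1 + L) * (t - s) ^ ρ)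

/-- The Lipschitz estimate for the map `Φ` of the integral equation on functions with Hölder
constant at most `M`. -/
def HasLipschitzBound (β ρ T : ℝ) (y₀ : E) (Φ : (ℝ → E) → ℝ → E) (M c : ℝ) : Prop :=
  ∀ y z, IsHolderFrom β T M y₀ y → IsHolderFrom β T M y₀ z →
    ∀ s t W V, 0 ≤ s → s < t → t ≤ T → 0 ≤ W → 0 ≤ V →
    (∀ u ∈ Icc s t, ‖y u - z u‖ ≤ W) →
    (∀ u ∈ Icc s t, ∀ v ∈ Icc s t, ‖y u - z u - (y v - z v)‖ ≤ V * |u - v| ^ β) →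
    ‖Φ y t - Φ z t - (Φ y s - Φ z s)‖ ≤ c * (W * (t - s) ^ β + (W + V) * (t - s) ^ ρ)

variable {Φ : (ℝ → E) → ℝ → E}

/-- The a priori bound: for a suitable weight some ball is mapped into itself. -/
lemma exists_invariant_ball (hβ : 0 < β) (hρ : β < ρ) {c : ℝ} (hc : 0 ≤ c)
    (h : HasGrowthBound β ρ T y₀ Φ c) :
    ∃ τ N, 0 < τ ∧ 0 ≤ N ∧ ∀ y, y 0 = y₀ → WeightedHolder β T τ N y →
      WeightedHolder β T τ N (Φ y) := by
  obtain ⟨τ, hτ, hτ1, hκ⟩ := exists_small_step hβ hρ c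
  -- The part of the bound that does not involve `N` has to be at most `N / 2`.
  set N := 2 * (c * (2 + ‖y₀‖)) with hN
  have hN0 : 0 ≤ N := by positivity
  refine ⟨τ, N, hτ, hN0, fun y hy0 hy s t hs hst ht hd => ?_⟩
  rcases hst.eq_or_lt with rfl | hlt
  · simp [Real.zero_rpow hβ.ne']
  set e := N * Real.exp (t / τ) with he
  have he0 : 0 ≤ e := by positivity
  obtain ⟨b1, b2⟩ := (hy.const_sub y₀).bound_on_Icc hβ hτ hN0 (by simp [hy0]) hs ht hd
  simp only [sub_sub_sub_cancel_right] at b2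
  have hmain := h _ y (hy.isHolderFrom hβ hτ hN0 hy0) s t (‖y₀‖ + 2 * τ ^ β * e) e hs hlt ht
    (by positivity) he0 (fun u hu => by
      have := norm_add_le (y u - y₀) y₀
      rw [sub_add_cancel] at this
      linarith [b1 u hu]) b2
  refine hmain.trans ?_
  obtain ⟨p1, p2⟩ := rpow_sub_le_step hτ1 hρ (sub_pos.2 hlt) hd
  have hr : 0 ≤ (t - s) ^ β := Real.rpow_nonneg (by linarith) _
  have hτρ : 0 ≤ τ ^ (ρ - β) := by positivity
  have hN1 : N ≤ e := le_mul_of_one_le_right hN0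
    (Real.one_le_exp (div_nonneg (hs.trans hst) hτ.le))
  have q1 : c * ((1 + (‖y₀‖ + 2 * τ ^ β * e)) * (t - s) ^ β + (1 + e) * (t - s) ^ ρ)
      ≤ c * ((1 + (‖y₀‖ + 2 * τ ^ β * e)) * (t - s) ^ β
        + ((t - s) ^ β + e * ((t - s) ^ β * τ ^ (ρ - β)))) := by
    refine mul_le_mul_of_nonneg_left ?_ hc
    nlinarith [mul_le_mul_of_nonneg_left p1 he0]
  have q2 : c * (2 * τ ^ β + τ ^ (ρ - β)) ≤ 1 / 2 := by nlinarith [mul_nonneg hc hτρ]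
  have q3 : c * (2 + ‖y₀‖) + c * (2 * τ ^ β + τ ^ (ρ - β)) * e ≤ e := by
    nlinarith [mul_le_mul_of_nonneg_right q2 he0]
  refine q1.trans ?_
  calc _ = (c * (2 + ‖y₀‖) + c * (2 * τ ^ β + τ ^ (ρ - β)) * e) * (t - s) ^ β := by ring
    _ ≤ e * (t - s) ^ β := by gcongr

/-- On paths with Hölder constant at most `M` the map contracts differences by `1/2`. The step `τ`
depends on `M` through the Lipschitz constant `c`. -/
lemma exists_contraction (hβ : 0 < β) (hρ : β < ρ) {c : ℝ} (hc : 0 ≤ c)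
    (h : HasLipschitzBound β ρ T y₀ Φ M c) :
    ∃ τ, 0 < τ ∧ ∀ y z N, IsHolderFrom β T M y₀ y → IsHolderFrom β T M y₀ z → 0 ≤ N →
      WeightedHolder β T τ N (fun t => y t - z t) →
      WeightedHolder β T τ (N / 2) (fun t => Φ y t - Φ z t) := by
  obtain ⟨τ, hτ, hτ1, hκ⟩ := exists_small_step hβ hρ c
  refine ⟨τ, hτ, fun y z N hy hz hN0 hw s t hs hst ht hd => ?_⟩
  rcases hst.eq_or_lt with rfl | hlt
  · simp [Real.zero_rpow hβ.ne']
  set e := N * Real.exp (t / τ) with he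
  have he0 : 0 ≤ e := by positivity
  obtain ⟨b1, b2⟩ := hw.bound_on_Icc hβ hτ hN0 (by simp [hy.initial, hz.initial]) hs ht hd
  have hmain := h y z hy hz s t (2 * τ ^ β * e) e hs hlt ht (by positivity) he0 b1 b2
  refine hmain.trans ?_
  obtain ⟨p1, -⟩ := rpow_sub_le_step hτ1 hρ (sub_pos.2 hlt) hd
  have hr : 0 ≤ (t - s) ^ β := Real.rpow_nonneg (by linarith) _
  have hτβ0 : 0 ≤ τ ^ β := by positivity
  have hτβ : τ ^ β ≤ 1 := Real.rpow_le_one hτ.le hτ1 hβ.le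
  have hτρ : 0 ≤ τ ^ (ρ - β) := by positivity
  have q0 : 2 * τ ^ β * e + e ≤ 3 * e := by nlinarith
  have q1 : (2 * τ ^ β * e + e) * (t - s) ^ ρ ≤ 3 * e * ((t - s) ^ β * τ ^ (ρ - β)) := by
    gcongr
  calc _ ≤ c * (2 * τ ^ β * e * (t - s) ^ β + 3 * e * ((t - s) ^ β * τ ^ (ρ - β))) := by gcongr
    _ = c * (2 * τ ^ β + 3 * τ ^ (ρ - β)) * (e * (t - s) ^ β) := by ring
    _ ≤ 1 / 2 * (e * (t - s) ^ β) := by gcongr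
    _ = N / 2 * Real.exp (t / τ) * (t - s) ^ β := by rw [he]; ring

lemma tendsto_const_mul_half_pow (c : ℝ) : Tendsto (fun n : ℕ => c * (1 / 2) ^ n) atTop (𝓝 0) := by
  simpa using (tendsto_pow_atTop_nhds_zero_of_lt_one (r := (1 / 2 : ℝ)) (by norm_num)
    (by norm_num)).const_mul c

lemma eqOn_of_weightedHolder (hβ : 0 < β) (hτ : 0 < τ) {K : ℝ} (hK : 0 ≤ K) (h0 : y 0 = z 0)
    (h : ∀ n : ℕ, WeightedHolder β T τ (K * (1 / 2) ^ n) (fun t => y t - z t)) :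
    EqOn y z (Icc 0 T) := by
  intro t ht
  have hb : ∀ n : ℕ, ‖y t - z t‖ ≤ 2 * τ ^ β * Real.exp (t / τ) * K * (1 / 2) ^ n := fun n => by
    refine ((h n).norm_le hβ hτ (by positivity) (by simp [h0]) ht).trans (le_of_eq ?_)
    ring
  have := ge_of_tendsto' (tendsto_const_mul_half_pow _) hb
  exact sub_eq_zero.1 (norm_le_zero_iff.1 this)

lemma eqOn_of_fixedPoint (hβ : 0 < β) (hρ : β < ρ) {c : ℝ} (hc : 0 ≤ c) (hM : 0 ≤ M)
    (h : HasLipschitzBound β ρ T y₀ Φ M c) (hy : IsHolderFrom β T M y₀ y)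
    (hz : IsHolderFrom β T M y₀ z) (hyΦ : EqOn (Φ y) y (Icc 0 T)) (hzΦ : EqOn (Φ z) z (Icc 0 T)) :
    EqOn y z (Icc 0 T) := by
  obtain ⟨τ, hτ, hcon⟩ := exists_contraction hβ hρ hc h
  refine eqOn_of_weightedHolder hβ hτ (K := 2 * M) (by positivity)
    (hy.initial.trans hz.initial.symm) fun n => ?_
  induction n with
  | zero => simpa using hy.weightedHolder_sub hτ hM hz
  | succ n ih =>
    have := hcon y z _ hy hz (by positivity) ih
    intro s t hs hst ht hd
    have h1 := this s t hs hst ht hd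
    simp only at h1 ⊢
    rw [hyΦ ⟨hs.trans hst, ht⟩, hzΦ ⟨hs.trans hst, ht⟩, hyΦ ⟨hs, hst.trans ht⟩,
      hzΦ ⟨hs, hst.trans ht⟩] at h1
    rw [pow_succ]
    calc _ ≤ _ := h1
      _ = _ := by ring

/-- Existence of a fixed point by Picard iteration: the iterates stay in the invariant ball, and
there they converge in the weighted Hölder norm of the contraction. -/
lemma exists_fixedPoint [CompleteSpace E] (hβ : 0 < β) (hρ : β < ρ) {c : ℝ} (hc : 0 ≤ c)
    (hT : 0 ≤ T) (hΦ0 : ∀ y, Φ y 0 = y₀) (hgrowth : HasGrowthBound β ρ T y₀ Φ c)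
    (hlip : ∀ M, ∃ c, 0 ≤ c ∧ HasLipschitzBound β ρ T y₀ Φ M c) :
    ∃ M y, 0 ≤ M ∧ IsHolderFrom β T M y₀ y ∧ EqOn (Φ y) y (Icc 0 T) := by
  obtain ⟨τ₁, N, hτ₁, hN, hinv⟩ := exists_invariant_ball hβ hρ hc hgrowth
  set M := 4 * (N * Real.exp (T / τ₁)) with hM
  have hM0 : 0 ≤ M := by positivity
  obtain ⟨c', hc', hl⟩ := hlip M
  obtain ⟨τ, hτ, hcon⟩ := exists_contraction hβ hρ hc' hl
  set p : ℕ → ℝ → E := fun n => Φ^[n] (fun _ => y₀) with hp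
  have hpS : ∀ n, p (n + 1) = Φ (p n) := fun n => Function.iterate_succ_apply' _ _ _
  have hp0 : ∀ n, p n 0 = y₀ := by
    intro n
    cases n with
    | zero => rfl
    | succ n => rw [hpS, hΦ0]
  have hpN : ∀ n, WeightedHolder β T τ₁ N (p n) := by
    intro n
    induction n with
    | zero =>
      intro s t hs hst ht _
      have : 0 ≤ (t - s) ^ β := Real.rpow_nonneg (by linarith) _
      simp only [hp, Function.iterate_zero, id, sub_self, norm_zero]
      positivity
    | succ n ih => rw [hpS]; exact hinv _ (hp0 n) ih
  have hpM : ∀ n, IsHolderFrom β T M y₀ (p n) := fun n =>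
    (hpN n).isHolderFrom hβ hτ₁ hN (hp0 n)
  have hstep : ∀ n, WeightedHolder β T τ (2 * M * (1 / 2) ^ n) (fun t => p (n + 1) t - p n t) := by
    intro n
    induction n with
    | zero => simpa using (hpM 1).weightedHolder_sub hτ hM0 (hpM 0)
    | succ n ih =>
      have := hcon _ _ _ (hpM (n + 1)) (hpM n) (by positivity) ih
      rw [← hpS, ← hpS] at this
      rwa [pow_succ, ← mul_assoc, mul_one_div]
  have hcauchy : ∀ n k, WeightedHolder β T τ
      (4 * M * (1 / 2) ^ n - 4 * M * (1 / 2) ^ (n + k)) (fun t => p (n + k) t - p n t) := by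
    intro n k
    induction k with
    | zero => intro s t _ _ _ _; simp
    | succ k ih =>
      intro s t hs hst ht hd
      have h1 := ih s t hs hst ht hd
      have h2 := hstep (n + k) s t hs hst ht hd
      have h3 := norm_add_le (p (n + k) t - p n t - (p (n + k) s - p n s))
        (p (n + k + 1) t - p (n + k) t - (p (n + k + 1) s - p (n + k) s))
      rw [show p (n + k) t - p n t - (p (n + k) s - p n s)
        + (p (n + k + 1) t - p (n + k) t - (p (n + k + 1) s - p (n + k) s))
        = p (n + k + 1) t - p n t - (p (n + k + 1) s - p n s) by abel] at h3
      refine (h3.trans (add_le_add h1 h2)).trans (le_of_eq ?_)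
      rw [← add_assoc n k 1, pow_succ]
      ring
  have hpt : ∀ t ∈ Icc 0 T, ∃ v, Tendsto (fun n => p n t) atTop (𝓝 v) := by
    intro t ht
    refine cauchySeq_tendsto_of_complete (cauchySeq_of_le_geometric (1 / 2)
      (2 * τ ^ β * Real.exp (t / τ) * (2 * M)) (by norm_num) fun n => ?_)
    rw [dist_comm, dist_eq_norm]
    refine ((hstep n).norm_le hβ hτ (by positivity) (by simp [hp0]) ht).trans (le_of_eq ?_)
    ring
  choose! y hy using hpt
  have h0T : (0 : ℝ) ∈ Icc 0 T := ⟨le_rfl, hT⟩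
  have hy0 : y 0 = y₀ := tendsto_nhds_unique (hy 0 h0T) (by simp [hp0])
  have hyM : IsHolderFrom β T M y₀ y := ⟨hy0, fun s hs t ht =>
    le_of_tendsto' ((hy s hs).sub (hy t ht)).norm fun n => (hpM n).holder s hs t ht⟩
  refine ⟨M, y, hM0, hyM, ?_⟩
  have hclose : ∀ n, WeightedHolder β T τ (4 * M * (1 / 2) ^ n) (fun t => y t - p n t) := by
    intro n s t hs hst ht hd
    have hs' : s ∈ Icc 0 T := ⟨hs, hst.trans ht⟩
    have ht' : t ∈ Icc 0 T := ⟨hs.trans hst, ht⟩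
    have l1 := (((hy t ht').comp (tendsto_add_atTop_nat n)).sub_const (p n t)).sub
      (((hy s hs').comp (tendsto_add_atTop_nat n)).sub_const (p n s))
    refine le_of_tendsto' l1.norm fun k => ?_
    have h1 := hcauchy n k s t hs hst ht hd
    simp only [Function.comp]
    rw [add_comm k n]
    refine h1.trans ?_
    have : 0 ≤ (t - s) ^ β := Real.rpow_nonneg (by linarith) _
    have : 0 ≤ 4 * M * (1 / 2) ^ (n + k) := by positivity
    gcongr
    linarith
  intro t ht
  have h1 : ∀ n, ‖Φ y t - p (n + 1) t‖
      ≤ 2 * τ ^ β * Real.exp (t / τ) * (4 * M / 2) * (1 / 2) ^ n := by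
    intro n
    have := hcon _ _ _ hyM (hpM n) (by positivity) (hclose n)
    rw [hpS]
    refine (this.norm_le hβ hτ (by positivity) (by simp [hΦ0]) ht).trans (le_of_eq ?_)
    ring
  have h2 : Tendsto (fun n => Φ y t - p (n + 1) t) atTop (𝓝 0) :=
    squeeze_zero_norm h1 (tendsto_const_mul_half_pow _)
  have h3 : Tendsto (fun n => Φ y t - p (n + 1) t) atTop (𝓝 (Φ y t - y t)) :=
    tendsto_const_nhds.sub ((hy t ht).comp (tendsto_add_atTop_nat 1))
  exact sub_eq_zero.1 (tendsto_nhds_unique h3 h2)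

end FixedPoint

/-! ### Drivers and coefficients -/

lemma IsHolderPath.mono {g : ℝ → ℝ} {α H R a b a' b' : ℝ} (hg : IsHolderPath g α H R a b)
    (h : Icc a' b' ⊆ Icc a b) : IsHolderPath g α H R a' b' :=
  ⟨hg.nonneg, hg.cont.mono h, fun t ht => hg.bound t (h ht),
    fun s hs t ht => hg.holder s (h hs) t (h ht)⟩

lemma IsHolderIntegrand.mono {f : ℝ → ℝ → ℝ} {β A B R a b a' b' : ℝ}
    (hf : IsHolderIntegrand f β A B R a b) (h : Icc a' b' ⊆ Icc a b) :
    IsHolderIntegrand f β A B R a' b' :=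
  ⟨fun t ht => hf.cont t (h ht), fun t ht => hf.bound t (h ht),
    fun s hs t ht => hf.holder s (h hs) t (h ht)⟩

lemma memHolder_iff {E : Type*} [SeminormedAddCommGroup E] {β T : ℝ} (hβ : 0 ≤ β) {y : ℝ → E} :
    MemHolder β T y ↔
      ∃ M, 0 ≤ M ∧ ∀ s ∈ Icc 0 T, ∀ t ∈ Icc 0 T, ‖y s - y t‖ ≤ M * |s - t| ^ β := by
  constructor
  · rintro ⟨C, hC⟩
    refine ⟨C, C.2, fun s hs t ht => ?_⟩
    have := hC.dist_le hs ht
    rwa [dist_eq_norm, Real.dist_eq, Real.coe_toNNReal β hβ] at this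
  · rintro ⟨M, hM, h⟩
    refine ⟨M.toNNReal, fun s hs t ht => ?_⟩
    have h1 := h s hs t ht
    rw [Real.coe_toNNReal β hβ, edist_nndist, edist_nndist, ← ENNReal.coe_rpow_of_nonneg _ hβ,
      ← ENNReal.coe_mul, ENNReal.coe_le_coe, ← NNReal.coe_le_coe]
    push_cast
    rwa [Real.coe_toNNReal M hM, dist_eq_norm, Real.dist_eq]

/-- The properties of the driver `x` that the integral equation uses: it is bounded by `R` and
`α`-Hölder with constant `H`, and integrals of `β₀`-Hölder integrands against its coordinates exist
and are controlled with constant `K`. -/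
structure IsDriver {d : ℕ} (x : ℝ → Fin d → ℝ) (α β₀ ρ H R K T : ℝ) : Prop where
  path : ∀ j, IsHolderPath (fun s => x s j) α H R 0 T
  bound : ∀ t ∈ Icc 0 T, ‖x t‖ ≤ R
  holder : ∀ s ∈ Icc 0 T, ∀ t ∈ Icc 0 T, ‖x s - x t‖ ≤ H * |s - t| ^ α
  integral : ∀ j f a b A B, 0 ≤ a → a < b → b ≤ T → 0 ≤ A → 0 ≤ B →
    IsHolderIntegrand f β₀ A B R a b → ∃ I, HasIntegral f (fun s => x s j) a b I ∧
      |I| ≤ K * (A * (b - a) ^ α + B * (b - a) ^ ρ)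

lemma exists_isDriver {d : ℕ} {x : ℝ → Fin d → ℝ} {α β₀ γ T : ℝ} (hT : 0 ≤ T) (hT1 : T ≤ 1)
    (hα : 0 < α) (hβ₀ : 0 ≤ β₀) (hxG : MemG β₀ γ T x) (hxα : MemHolder α T x) :
    ∃ H R K, 0 ≤ H ∧ 0 ≤ R ∧ 0 ≤ K ∧ IsDriver x α β₀ (β₀ + γ) H R K T := by
  obtain ⟨H, hH0, hH⟩ := (memHolder_iff hα.le).1 hxα
  obtain ⟨hcont, C, hC⟩ := hxG
  have h0T : (0 : ℝ) ∈ Icc 0 T := ⟨le_rfl, hT⟩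
  have hR : ∀ t ∈ Icc 0 T, ‖x t‖ ≤ ‖x 0‖ + H := by
    intro t ht
    have h1 := hH t ht 0 h0T
    have h2 : |t - 0| ^ α ≤ 1 := Real.rpow_le_one (abs_nonneg _)
      (by rw [sub_zero, abs_of_nonneg ht.1]; exact ht.2.trans hT1) hα.le
    have h3 := norm_add_le (x t - x 0) (x 0)
    rw [sub_add_cancel] at h3
    nlinarith
  have hpath : ∀ j, IsHolderPath (fun s => x s j) α H (‖x 0‖ + H) 0 T := fun j =>
    ⟨hH0, (continuous_apply j).comp_continuousOn hcont,
      fun t ht => (norm_le_pi_norm (x t) j).trans (hR t ht),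
      fun s hs t ht => (norm_le_pi_norm (x s - x t) j).trans (hH s hs t ht)⟩
  have hr1 : (1 / 2 : ℝ) ^ α < 1 := Real.rpow_lt_one (by norm_num) (by norm_num) hα
  have hK1 : 0 ≤ (2 + 12 / (1 - (1 / 2 : ℝ) ^ α)) * H :=
    mul_nonneg (add_nonneg (by norm_num) (div_nonneg (by norm_num) (by linarith))) hH0
  refine ⟨H, ‖x 0‖ + H, (2 + 12 / (1 - (1 / 2 : ℝ) ^ α)) * H + |C|, hH0, by positivity,
    by positivity, hpath, hR, hH, ?_⟩
  intro j f a b A B ha hab hb hA hB hf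
  obtain ⟨I, hI, hle⟩ := exists_hasIntegral ha hab (hb.trans hT1) hα hβ₀
    ((hpath j).mono (Icc_subset_Icc ha hb)) hf hA hB (hC a b ha hab hb j)
  refine ⟨I, hI, hle.trans ?_⟩
  have p1 : 0 ≤ A * (b - a) ^ α := mul_nonneg hA (Real.rpow_nonneg (by linarith) _)
  have p2 : 0 ≤ B * (b - a) ^ (β₀ + γ) := mul_nonneg hB (Real.rpow_nonneg (by linarith) _)
  have p3 : B * (C * (b - a) ^ (β₀ + γ)) ≤ |C| * (B * (b - a) ^ (β₀ + γ)) := by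
    rw [mul_left_comm]
    exact mul_le_mul_of_nonneg_right (le_abs_self C) p2
  nlinarith [mul_nonneg hK1 p2, mul_nonneg (abs_nonneg C) p1]

/-- The value of `∫_0^t f(u, g(u)) dg(u)`, which is meaningful if the integral exists. -/
noncomputable def integralValue (f : ℝ → ℝ → ℝ) (g : ℝ → ℝ) (t : ℝ) : ℝ :=
  limUnder atTop (lineIntegral f g 0 t)

lemma HasIntegral.integralValue_eq {f : ℝ → ℝ → ℝ} {g : ℝ → ℝ} {t I : ℝ}
    (h : HasIntegral f g 0 t I) : integralValue f g t = I :=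
  Tendsto.limUnder_eq h

section Driver

variable {d : ℕ} {x : ℝ → Fin d → ℝ} {α β₀ ρ H R K T : ℝ}

lemma IsDriver.hasIntegral (hx : IsDriver x α β₀ ρ H R K T) {j : Fin d}
    {f : ℝ → ℝ → ℝ} {A B : ℝ} (hA : 0 ≤ A) (hB : 0 ≤ B) (hf : IsHolderIntegrand f β₀ A B R 0 T)
    {t : ℝ} (ht : t ∈ Icc 0 T) :
    HasIntegral f (fun s => x s j) 0 t (integralValue f (fun s => x s j) t) := by
  obtain ⟨I, hI⟩ : ∃ I, HasIntegral f (fun s => x s j) 0 t I := by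
    rcases ht.1.eq_or_lt with rfl | h0
    · exact ⟨0, hasIntegral_self _ _ le_rfl zero_le_one⟩
    · obtain ⟨I, hI, -⟩ := hx.integral j f 0 t A B le_rfl h0 ht.2 hA hB
        (hf.mono (Icc_subset_Icc le_rfl ht.2))
      exact ⟨I, hI⟩
  rwa [hI.integralValue_eq]

lemma IsDriver.hasIntegral_sub (hx : IsDriver x α β₀ ρ H R K T) (hT1 : T ≤ 1) (hα : 0 < α)
    {j : Fin d} {f : ℝ → ℝ → ℝ} {A B : ℝ} (hA : 0 ≤ A) (hB : 0 ≤ B)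
    (hf : IsHolderIntegrand f β₀ A B R 0 T) {s t : ℝ} (hs : 0 ≤ s) (hst : s ≤ t) (ht : t ≤ T) :
    HasIntegral f (fun s => x s j) s t
      (integralValue f (fun s => x s j) t - integralValue f (fun s => x s j) s) :=
  HasIntegral.sub_left hs hst (ht.trans hT1) hα ((hx.path j).mono (Icc_subset_Icc le_rfl ht))
    (hf.mono (Icc_subset_Icc le_rfl ht)) hA
    (hx.hasIntegral hA hB hf ⟨hs, hst.trans ht⟩)
    (hx.hasIntegral hA hB hf ⟨hs.trans hst, ht⟩)

lemma IsDriver.abs_integralValue_sub_le (hx : IsDriver x α β₀ ρ H R K T) (hT1 : T ≤ 1)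
    (hα : 0 < α) {j : Fin d} {f : ℝ → ℝ → ℝ} {A' B' A B : ℝ} (hA' : 0 ≤ A') (hB' : 0 ≤ B')
    (hf : IsHolderIntegrand f β₀ A' B' R 0 T) {s t : ℝ} (hs : 0 ≤ s) (hst : s < t) (ht : t ≤ T)
    (hA : 0 ≤ A) (hB : 0 ≤ B) (hf' : IsHolderIntegrand f β₀ A B R s t) :
    |integralValue f (fun s => x s j) t - integralValue f (fun s => x s j) s|
      ≤ K * (A * (t - s) ^ α + B * (t - s) ^ ρ) := by
  obtain ⟨I, hI, hle⟩ := hx.integral j f s t A B hs hst ht hA hB hf'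
  rwa [tendsto_nhds_unique (hx.hasIntegral_sub hT1 hα hA' hB' hf hs hst.le ht) hI]

lemma IsDriver.abs_integralValue_sub_sub_le (hx : IsDriver x α β₀ ρ H R K T) (hT1 : T ≤ 1)
    (hα : 0 < α) {j : Fin d} {f₁ f₂ : ℝ → ℝ → ℝ} {A' B' A B : ℝ} (hA' : 0 ≤ A') (hB' : 0 ≤ B')
    (hf₁ : IsHolderIntegrand f₁ β₀ A' B' R 0 T) (hf₂ : IsHolderIntegrand f₂ β₀ A' B' R 0 T)
    {s t : ℝ} (hs : 0 ≤ s) (hst : s < t) (ht : t ≤ T) (hA : 0 ≤ A) (hB : 0 ≤ B)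
    (hf' : IsHolderIntegrand (fun u ξ => f₁ u ξ - f₂ u ξ) β₀ A B R s t) :
    |integralValue f₁ (fun s => x s j) t - integralValue f₂ (fun s => x s j) t
        - (integralValue f₁ (fun s => x s j) s - integralValue f₂ (fun s => x s j) s)|
      ≤ K * (A * (t - s) ^ α + B * (t - s) ^ ρ) := by
  obtain ⟨I, hI, hle⟩ := hx.integral j _ s t A B hs hst ht hA hB hf'
  have hsub : Icc s t ⊆ Icc 0 T := Icc_subset_Icc hs ht
  have h := HasIntegral.sub_integrand (hs.trans hst.le) (ht.trans hT1)
    (fun u hu => hf₁.cont u (hsub hu)) (fun u hu => hf₂.cont u (hsub hu))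
    (hx.hasIntegral_sub hT1 hα (j := j) hA' hB' hf₁ hs hst.le ht)
    (hx.hasIntegral_sub hT1 hα (j := j) hA' hB' hf₂ hs hst.le ht)
  rw [sub_sub_sub_comm, tendsto_nhds_unique h hI]
  exact hle

end Driver

lemma exists_uniform_const {ι κ : Type*} [Finite ι] [Finite κ] {P : ι → κ → ℝ → Prop}
    (hmono : ∀ i j C C', C ≤ C' → P i j C → P i j C') (h : ∀ i j, ∃ C, P i j C) :
    ∃ C, 0 ≤ C ∧ ∀ i j, P i j C := by
  have h1 : ∀ᶠ C : ℝ in atTop, ∀ i j, P i j C := by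
    rw [eventually_all]
    intro i
    rw [eventually_all]
    intro j
    obtain ⟨C, hC⟩ := h i j
    exact (eventually_ge_atTop C).mono fun C' hC' => hmono i j C C' hC' hC
  obtain ⟨C, hC0, hC⟩ := ((eventually_ge_atTop (0 : ℝ)).and h1).exists
  exact ⟨C, hC0, hC⟩

lemma rpow_le_one_add {L θ : ℝ} (hL : 0 ≤ L) (hθ : 0 ≤ θ) (hθ1 : θ ≤ 1) : L ^ θ ≤ 1 + L := by
  rcases le_total L 1 with h | h
  · exact (Real.rpow_le_one hL h hθ).trans (by linarith)
  · exact (Real.rpow_le_rpow_of_exponent_le h hθ1).trans (by rw [Real.rpow_one]; linarith)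

lemma rpow_le_of_le_mul_rpow {n L r β β₀ θ : ℝ} (hn : 0 ≤ n) (hL : 0 ≤ L) (hr : 0 ≤ r)
    (hr1 : r ≤ 1) (hθ : 0 ≤ θ) (hθ1 : θ ≤ 1) (hβ₀ : 0 ≤ β₀) (h : β₀ ≤ θ * β)
    (hle : n ≤ L * r ^ β) : n ^ θ ≤ (1 + L) * r ^ β₀ := by
  have h1 : n ^ θ ≤ L ^ θ * r ^ (θ * β) := by
    refine (Real.rpow_le_rpow hn hle hθ).trans (le_of_eq ?_)
    rw [Real.mul_rpow hL (Real.rpow_nonneg hr _), ← Real.rpow_mul hr, mul_comm β θ]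
  refine h1.trans (mul_le_mul (rpow_le_one_add hL hθ hθ1)
    (Real.rpow_le_rpow_of_exponent_ge' hr hr1 hβ₀ h) (Real.rpow_nonneg hr _) (by linarith))

section Coefficient

variable {m d : ℕ} {θ : ℝ} {F : ℝ → (Fin m → ℝ) → (Fin d → ℝ) → Matrix (Fin m) (Fin d) ℝ}

lemma IsAdmissible.exists_holder_const (hF : IsAdmissible θ F) (R : ℝ) :
    ∃ C, 0 ≤ C ∧ ∀ i j, ∀ t ∈ Icc (0 : ℝ) 1, ∀ t' ∈ Icc (0 : ℝ) 1,
      ∀ y y' : Fin m → ℝ, ∀ x x' : Fin d → ℝ, ‖x‖ ≤ R → ‖x'‖ ≤ R → x j = x' j →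
      |F t y x i j - F t' y' x' i j| ≤ C * (|t - t'| ^ θ + ‖y - y'‖ ^ θ + ‖x - x'‖ ^ θ) := by
  refine exists_uniform_const (fun i j C C' hCC h t ht t' ht' y y' x x' hx hx' hj => ?_)
    fun i j => hF.holder i j R
  exact (h t ht t' ht' y y' x x' hx hx' hj).trans
    (mul_le_mul_of_nonneg_right hCC (by positivity))

lemma IsAdmissible.exists_holder_deriv_const (hF : IsAdmissible θ F) (R : ℝ) :
    ∃ C, 0 ≤ C ∧ ∀ i j, ∀ t ∈ Icc (0 : ℝ) 1, ∀ t' ∈ Icc (0 : ℝ) 1,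
      ∀ y y' : Fin m → ℝ, ‖y‖ ≤ R → ‖y'‖ ≤ R →
      ∀ x x' : Fin d → ℝ, ‖x‖ ≤ R → ‖x'‖ ≤ R → x j = x' j →
      ‖fderiv ℝ (fun z : Fin m → ℝ => F t z x i j) y
          - fderiv ℝ (fun z : Fin m → ℝ => F t' z x' i j) y'‖
        ≤ C * (|t - t'| ^ θ + ‖y - y'‖ ^ θ + ‖x - x'‖ ^ θ) := by
  refine exists_uniform_const (fun i j C C' hCC h t ht t' ht' y y' hy hy' x x' hx hx' hj => ?_)
    fun i j => hF.holder_deriv i j R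
  exact (h t ht t' ht' y y' hy hy' x x' hx hx' hj).trans
    (mul_le_mul_of_nonneg_right hCC (by positivity))

lemma IsAdmissible.exists_growth_const (hF : IsAdmissible θ F) (hθ : 0 < θ) (hθ1 : θ ≤ 1) (R : ℝ) :
    ∃ A, 0 ≤ A ∧ ∀ i j, ∀ t ∈ Icc (0 : ℝ) 1, ∀ (y : Fin m → ℝ) (x : Fin d → ℝ), ‖x‖ ≤ R →
      |F t y x i j| ≤ A * (1 + ‖y‖) := by
  obtain ⟨C, hC0, hC⟩ := hF.exists_holder_const R
  obtain ⟨A₀, hA₀, hA⟩ : ∃ A, 0 ≤ A ∧ ∀ i j, ∀ x : Fin d → ℝ, ‖x‖ ≤ R → |F 0 0 x i j| ≤ A := by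
    refine exists_uniform_const (P := fun i j A => ∀ x : Fin d → ℝ, ‖x‖ ≤ R → |F 0 0 x i j| ≤ A)
      (fun i j C C' hCC h x hx => (h x hx).trans hCC) fun i j => ?_
    have hcont : ContinuousOn (fun x : Fin d → ℝ => F 0 0 x i j) (Metric.closedBall 0 R) :=
      (hF.continuous i j).comp (f := fun x : Fin d → ℝ => ((0 : ℝ), (0 : Fin m → ℝ), x))
        (by fun_prop) fun x _ => ⟨mem_Ici.2 le_rfl, mem_univ _⟩
    obtain ⟨A, hA⟩ := (isCompact_closedBall (0 : Fin d → ℝ) R).exists_bound_of_continuousOn hcont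
    exact ⟨A, fun x hx => hA x (by simpa using hx)⟩
  refine ⟨A₀ + 2 * C, by positivity, fun i j t ht y x hx => ?_⟩
  have h1 := hC i j t ht 0 ⟨le_rfl, zero_le_one⟩ y 0 x x hx hx rfl
  rw [sub_zero, sub_zero, sub_self, norm_zero, Real.zero_rpow hθ.ne', add_zero,
    abs_of_nonneg ht.1] at h1
  have h2 := hA i j x hx
  have h3 : t ^ θ ≤ 1 := Real.rpow_le_one ht.1 ht.2 hθ.le
  have h4 := rpow_le_one_add (norm_nonneg y) hθ.le hθ1
  have h5 : |F t y x i j| ≤ |F t y x i j - F 0 0 x i j| + |F 0 0 x i j| := by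
    simpa using abs_add_le (F t y x i j - F 0 0 x i j) (F 0 0 x i j)
  have h6 := mul_le_mul_of_nonneg_left (add_le_add h3 h4) hC0
  nlinarith [mul_nonneg hA₀ (norm_nonneg y), mul_nonneg hC0 (norm_nonneg y)]

/-- The derivative `D_y F_{ij}` is not assumed to depend continuously on `x_j`, so it is bounded
through the difference `F(t, v, x) - F(t, 0, x)` for unit vectors `v`. -/
lemma IsAdmissible.exists_fderiv_bound (hF : IsAdmissible θ F) (hθ : 0 < θ) (hθ1 : θ ≤ 1) (R : ℝ) :
    ∃ D, 0 ≤ D ∧ ∀ i j, ∀ t ∈ Icc (0 : ℝ) 1, ∀ (y : Fin m → ℝ) (x : Fin d → ℝ), ‖y‖ ≤ R → ‖x‖ ≤ R →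
      ‖fderiv ℝ (fun z : Fin m → ℝ => F t z x i j) y‖ ≤ D := by
  obtain ⟨C, hC0, hC⟩ := hF.exists_holder_const R
  obtain ⟨C', hC'0, hC'⟩ := hF.exists_holder_deriv_const (max R 1)
  have hm1 : (1 : ℝ) ≤ max R 1 := le_max_right _ _
  have hmR : R ≤ max R 1 := le_max_left _ _
  refine ⟨C + C' + C' * (1 + max R 1), by positivity, fun i j t ht y x hy hx => ?_⟩
  set φ : (Fin m → ℝ) → ℝ := fun z => F t z x i j with hφ
  have hdiff : Differentiable ℝ φ := hF.differentiable i j t ht.1 x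
  have hd : ∀ z : Fin m → ℝ, ‖z‖ ≤ max R 1 → ‖fderiv ℝ φ z - fderiv ℝ φ 0‖ ≤ C' * ‖z‖ ^ θ := by
    intro z hz
    have := hC' i j t ht t ht z 0 hz (by simp) x x (hx.trans hmR) (hx.trans hmR) rfl
    simpa [Real.zero_rpow hθ.ne'] using this
  have h0 : ‖fderiv ℝ φ 0‖ ≤ C + C' := by
    refine ContinuousLinearMap.opNorm_le_of_unit_norm (by positivity) fun v hv => ?_
    have h1 := (convex_closedBall (0 : Fin m → ℝ) 1).norm_image_sub_le_of_norm_fderiv_le'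
      (f := φ) (φ := fderiv ℝ φ 0) (C := C') (x := 0) (y := v) (𝕜 := ℝ) (fun z _ => hdiff z)
      (fun z hz => by
        have hz1 : ‖z‖ ≤ 1 := by simpa using hz
        refine (hd z (hz1.trans hm1)).trans ?_
        exact mul_le_of_le_one_right hC'0 (Real.rpow_le_one (norm_nonneg _) hz1 hθ.le))
      (by simp) (by simp [hv])
    rw [sub_zero, hv, mul_one] at h1
    have h2 := hC i j t ht t ht v 0 x x hx hx rfl
    rw [sub_self, abs_zero, Real.zero_rpow hθ.ne', sub_zero, hv, Real.one_rpow, sub_self,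
      norm_zero, Real.zero_rpow hθ.ne', zero_add, add_zero, mul_one] at h2
    rw [Real.norm_eq_abs] at *
    have h3 : |φ v - φ 0| ≤ C := h2
    rw [abs_le] at *
    constructor <;> linarith [h1.1, h1.2, h3.1, h3.2]
  have h1 := hd y (hy.trans hmR)
  have h2 : ‖y‖ ^ θ ≤ 1 + max R 1 :=
    (rpow_le_one_add (norm_nonneg y) hθ.le hθ1).trans (by linarith)
  have h3 := norm_add_le (fderiv ℝ φ y - fderiv ℝ φ 0) (fderiv ℝ φ 0)
  rw [sub_add_cancel] at h3
  nlinarith [mul_le_mul_of_nonneg_left h2 hC'0]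

/-- The Lipschitz estimate in `y`, and the Hölder estimate for differences in `y`. -/
lemma IsAdmissible.exists_sub_const (hF : IsAdmissible θ F) (hθ : 0 < θ) (hθ1 : θ ≤ 1) (R : ℝ) :
    ∃ D, 0 ≤ D ∧ ∀ i j, ∀ t ∈ Icc (0 : ℝ) 1, ∀ y z : Fin m → ℝ, ‖y‖ ≤ R → ‖z‖ ≤ R →
      ∀ x : Fin d → ℝ, ‖x‖ ≤ R → |F t y x i j - F t z x i j| ≤ D * ‖y - z‖ ∧
      ∀ t' ∈ Icc (0 : ℝ) 1, ∀ y' z' : Fin m → ℝ, ‖y'‖ ≤ R → ‖z'‖ ≤ R →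
      ∀ x' : Fin d → ℝ, ‖x'‖ ≤ R → x j = x' j →
        |F t y x i j - F t z x i j - (F t' y' x' i j - F t' z' x' i j)|
          ≤ D * (|t - t'| ^ θ + (‖y - y'‖ + ‖z - z'‖) ^ θ + ‖x - x'‖ ^ θ) * ‖y - z‖
            + D * ‖y - z - (y' - z')‖ := by
  obtain ⟨D, hD0, hD⟩ := hF.exists_fderiv_bound hθ hθ1 R
  obtain ⟨C, hC0, hC⟩ := hF.exists_holder_deriv_const R
  refine ⟨max C D, by positivity, fun i j t ht y z hy hz x hx => ⟨?_, ?_⟩⟩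
  · have h1 := (convex_closedBall (0 : Fin m → ℝ) R).norm_image_sub_le_of_norm_fderiv_le
      (f := fun z => F t z x i j) (C := D) (x := z) (y := y) (𝕜 := ℝ)
      (fun z _ => hF.differentiable i j t ht.1 x z)
      (fun z hz => hD i j t ht z x (by simpa using hz) hx) (by simpa using hz) (by simpa using hy)
    exact h1.trans (mul_le_mul_of_nonneg_right (le_max_right _ _) (norm_nonneg _))
  · intro t' ht' y' z' hy' hz' x' hx' hj
    set w := y - z with hw
    set w' := y' - z' with hw'
    have hball : ∀ {p q : Fin m → ℝ}, ‖p‖ ≤ R → ‖q‖ ≤ R → ∀ s ∈ Icc (0 : ℝ) 1,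
        ‖q + s • (p - q)‖ ≤ R := by
      intro p q hp hq s hs
      have := (convex_closedBall (0 : Fin m → ℝ) R).add_smul_sub_mem (x := q) (y := p)
        (by simpa using hq) (by simpa using hp) hs
      simpa using this
    have hder : ∀ (t : ℝ), 0 ≤ t → ∀ (x : Fin d → ℝ) (p q : Fin m → ℝ) (s : ℝ),
        HasDerivAt (fun s : ℝ => F t (q + s • p) x i j)
          (fderiv ℝ (fun z => F t z x i j) (q + s • p) p) s := by
      intro t ht x p q s
      have h1 : HasDerivAt (fun s : ℝ => q + s • p) p s := by
        simpa using ((hasDerivAt_id s).smul_const p).const_add q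
      exact (hF.differentiable i j t ht x (q + s • p)).hasFDerivAt.comp_hasDerivAt s h1
    set e := |t - t'| ^ θ + (‖y - y'‖ + ‖z - z'‖) ^ θ + ‖x - x'‖ ^ θ with he
    have he0 : 0 ≤ e := by positivity
    have hmv := norm_image_sub_le_of_norm_deriv_le_segment_01'
      (f := fun s : ℝ => F t (z + s • w) x i j - F t' (z' + s • w') x' i j)
      (C := C * e * ‖w‖ + D * ‖w - w'‖)
      (fun s _ => ((hder t ht.1 x w z s).sub (hder t' ht'.1 x' w' z' s)).hasDerivWithinAt)
      (fun s hs => by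
        have hs' : s ∈ Icc (0 : ℝ) 1 := Ico_subset_Icc_self hs
        have b1 := hball hy hz s hs'
        have b2 := hball hy' hz' s hs'
        rw [← hw] at b1
        rw [← hw'] at b2
        have h1 := hC i j t ht t' ht' _ _ b1 b2 x x' hx hx' hj
        have h2 := hD i j t' ht' _ x' b2 hx'
        set S := fderiv ℝ (fun z => F t z x i j) (z + s • w)
        set S' := fderiv ℝ (fun z => F t' z x' i j) (z' + s • w')
        have h3 : ‖z + s • w - (z' + s • w')‖ ≤ ‖y - y'‖ + ‖z - z'‖ := by
          have e1 : z + s • w - (z' + s • w') = s • (y - y') + (1 - s) • (z - z') := by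
            rw [hw, hw']
            module
          rw [e1]
          refine (norm_add_le _ _).trans ?_
          rw [norm_smul, norm_smul, Real.norm_of_nonneg hs'.1,
            Real.norm_of_nonneg (by linarith [hs'.2])]
          exact add_le_add (mul_le_of_le_one_left (norm_nonneg _) hs'.2)
            (mul_le_of_le_one_left (norm_nonneg _) (by linarith [hs'.1]))
        have h4 : ‖S - S'‖ ≤ C * e := by
          refine h1.trans (mul_le_mul_of_nonneg_left ?_ hC0)
          have := Real.rpow_le_rpow (norm_nonneg _) h3 hθ.le
          rw [he]
          linarith
        have e2 : S w - S' w' = (S - S') w + S' (w - w') := by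
          simp only [sub_apply, map_sub]
          ring
        rw [e2]
        refine (norm_add_le _ _).trans (add_le_add ?_ ?_)
        · exact ((S - S').le_opNorm w).trans (by gcongr)
        · exact (S'.le_opNorm _).trans (by gcongr))
    simp only [one_smul, zero_smul, add_zero] at hmv
    rw [hw, hw', add_sub_cancel, add_sub_cancel, ← hw, ← hw', Real.norm_eq_abs,
      sub_sub_sub_comm] at hmv
    refine hmv.trans (add_le_add ?_ ?_)
    · exact mul_le_mul_of_nonneg_right (mul_le_mul_of_nonneg_right (le_max_left _ _) he0)
        (norm_nonneg _)
    · exact mul_le_mul_of_nonneg_right (le_max_right _ _) (norm_nonneg _)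

end Coefficient

/-! ### The solution map -/

section SolutionMap

variable {m d : ℕ}

/-- The integrand `(u, ξ) ↦ F_{ij}(u, y(u), x_1(u), …, ξ, …, x_d(u))`, with `ξ` in place `j`. -/
def coefficient (F : ℝ → (Fin m → ℝ) → (Fin d → ℝ) → Matrix (Fin m) (Fin d) ℝ)
    (x : ℝ → Fin d → ℝ) (y : ℝ → Fin m → ℝ) (i : Fin m) (j : Fin d) : ℝ → ℝ → ℝ :=
  fun u ξ => F u (y u) (Function.update (x u) j ξ) i j

/-- The right-hand side of the integral equation; the solutions are the fixed points of this
map. -/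
noncomputable def solutionMap (F : ℝ → (Fin m → ℝ) → (Fin d → ℝ) → Matrix (Fin m) (Fin d) ℝ)
    (x : ℝ → Fin d → ℝ) (y₀ : Fin m → ℝ) (y : ℝ → Fin m → ℝ) : ℝ → Fin m → ℝ :=
  fun t i => y₀ i + ∑ j, integralValue (coefficient F x y i j) (fun s => x s j) t

variable {F : ℝ → (Fin m → ℝ) → (Fin d → ℝ) → Matrix (Fin m) (Fin d) ℝ} {x : ℝ → Fin d → ℝ}
  {α β β₀ ρ θ H R K T : ℝ} {y z : ℝ → Fin m → ℝ} {y₀ : Fin m → ℝ}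

lemma solutionMap_zero : solutionMap F x y₀ y 0 = y₀ := by
  ext i
  simp [solutionMap, (hasIntegral_self _ _ le_rfl zero_le_one).integralValue_eq]

lemma norm_update_le {a : Fin d → ℝ} {R ξ : ℝ} (hR : 0 ≤ R) (ha : ‖a‖ ≤ R) (hξ : |ξ| ≤ R)
    (j : Fin d) : ‖Function.update a j ξ‖ ≤ R := by
  rw [pi_norm_le_iff_of_nonneg hR]
  intro k
  rcases eq_or_ne k j with rfl | h
  · simpa using hξ
  · rw [Function.update_of_ne h]
    exact (norm_le_pi_norm a k).trans ha

lemma norm_update_sub_update_le (a b : Fin d → ℝ) (ξ : ℝ) (j : Fin d) :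
    ‖Function.update a j ξ - Function.update b j ξ‖ ≤ ‖a - b‖ := by
  rw [pi_norm_le_iff_of_nonneg (norm_nonneg _)]
  intro k
  rcases eq_or_ne k j with rfl | h
  · simp
  · rw [Pi.sub_apply, Function.update_of_ne h, Function.update_of_ne h]
    exact norm_le_pi_norm (a - b) k

lemma IsAdmissible.continuous_coefficient (hF : IsAdmissible θ F) (x : ℝ → Fin d → ℝ)
    (y : ℝ → Fin m → ℝ) (i : Fin m) (j : Fin d) {t : ℝ} (ht : 0 ≤ t) :
    Continuous (coefficient F x y i j t) := by
  rw [← continuousOn_univ]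
  refine (hF.continuous i j).comp (f := fun ξ : ℝ => (t, y t, Function.update (x t) j ξ)) ?_
    fun ξ _ => ⟨mem_Ici.2 ht, mem_univ _⟩
  exact (continuous_const.prodMk (continuous_const.prodMk
    (Continuous.update (continuous_const (y := x t)) j continuous_id))).continuousOn

/-- Since `T ≤ 1`, all time differences are at most `1`, and every Hölder exponent that occurs may be
lowered to `β₀ ≤ θ β`. -/
lemma IsDriver.rpow_update_le (hx : IsDriver x α β₀ ρ H R K T) (hT1 : T ≤ 1)
    (hβα : β ≤ α) (hα1 : α ≤ 1) (hθ : 0 ≤ θ) (hθ1 : θ ≤ 1) (hβ₀ : 0 ≤ β₀) (hβ₀θ : β₀ ≤ θ * β)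
    (hH : 0 ≤ H) {s t n L : ℝ} (hs : s ∈ Icc 0 T) (ht : t ∈ Icc 0 T) (hn : 0 ≤ n) (hL : 0 ≤ L)
    (hnL : n ≤ L * |s - t| ^ β) (ξ : ℝ) (j : Fin d) :
    |s - t| ^ θ + n ^ θ + ‖Function.update (x s) j ξ - Function.update (x t) j ξ‖ ^ θ
      ≤ (3 + H + L) * |s - t| ^ β₀ := by
  have hd : |s - t| ≤ 1 := by
    rw [abs_le]
    constructor <;> linarith [hs.1, hs.2, ht.1, ht.2]
  have h0 : 0 ≤ |s - t| := abs_nonneg _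
  have hθα : β₀ ≤ θ * α := hβ₀θ.trans (by gcongr)
  have h1 := rpow_le_of_le_mul_rpow (norm_nonneg _) hH h0 hd hθ hθ1 hβ₀ hθα
    ((norm_update_sub_update_le (x s) (x t) ξ j).trans (hx.holder s hs t ht))
  have h2 := rpow_le_of_le_mul_rpow hn hL h0 hd hθ hθ1 hβ₀ hβ₀θ hnL
  have h3 : |s - t| ^ θ ≤ |s - t| ^ β₀ := Real.rpow_le_rpow_of_exponent_ge' h0 hd hβ₀
    (hβ₀θ.trans (mul_le_of_le_one_right hθ (hβα.trans hα1)))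
  linarith

lemma IsDriver.isHolderIntegrand_coefficient (hx : IsDriver x α β₀ ρ H R K T) (hT1 : T ≤ 1)
    (hβα : β ≤ α) (hα1 : α ≤ 1) (hθ : 0 ≤ θ) (hθ1 : θ ≤ 1) (hβ₀ : 0 ≤ β₀) (hβ₀θ : β₀ ≤ θ * β)
    (hH : 0 ≤ H) (hR : 0 ≤ R) (hF : IsAdmissible θ F) {i : Fin m} {j : Fin d} {A C : ℝ}
    (hA0 : 0 ≤ A) (hC0 : 0 ≤ C)
    (hA : ∀ t ∈ Icc (0 : ℝ) 1, ∀ (y : Fin m → ℝ) (x : Fin d → ℝ), ‖x‖ ≤ R →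
      |F t y x i j| ≤ A * (1 + ‖y‖))
    (hC : ∀ t ∈ Icc (0 : ℝ) 1, ∀ t' ∈ Icc (0 : ℝ) 1,
      ∀ y y' : Fin m → ℝ, ∀ x x' : Fin d → ℝ, ‖x‖ ≤ R → ‖x'‖ ≤ R → x j = x' j →
      |F t y x i j - F t' y' x' i j| ≤ C * (|t - t'| ^ θ + ‖y - y'‖ ^ θ + ‖x - x'‖ ^ θ))
    {a b Y L : ℝ} (ha : 0 ≤ a) (hb : b ≤ T) (hL : 0 ≤ L) (hY : ∀ u ∈ Icc a b, ‖y u‖ ≤ Y)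
    (hyL : ∀ u ∈ Icc a b, ∀ v ∈ Icc a b, ‖y u - y v‖ ≤ L * |u - v| ^ β) :
    IsHolderIntegrand (coefficient F x y i j) β₀ (A * (1 + Y)) (C * (3 + H + L)) R a b := by
  have hsub : Icc a b ⊆ Icc 0 T := Icc_subset_Icc ha hb
  have hsub1 : Icc a b ⊆ Icc 0 1 := Icc_subset_Icc ha (hb.trans hT1)
  refine ⟨fun t ht => hF.continuous_coefficient x y i j (hsub ht).1, fun t ht ξ hξ => ?_,
    fun s hs t ht ξ hξ => ?_⟩
  · refine (hA t (hsub1 ht) _ _ (norm_update_le hR (hx.bound t (hsub ht)) hξ j)).trans ?_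
    have := hY t ht
    gcongr
  · refine (hC s (hsub1 hs) t (hsub1 ht) _ _ _ _
      (norm_update_le hR (hx.bound s (hsub hs)) hξ j)
      (norm_update_le hR (hx.bound t (hsub ht)) hξ j) (by simp)).trans ?_
    rw [mul_assoc]
    exact mul_le_mul_of_nonneg_left (hx.rpow_update_le hT1 hβα hα1 hθ hθ1 hβ₀ hβ₀θ hH (hsub hs)
      (hsub ht) (norm_nonneg _) hL (hyL s hs t ht) ξ j) hC0

lemma IsDriver.isHolderIntegrand_coefficient_sub (hx : IsDriver x α β₀ ρ H R K T) (hT1 : T ≤ 1)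
    (hβ : 0 < β) (hβα : β ≤ α) (hα1 : α ≤ 1) (hθ : 0 ≤ θ) (hθ1 : θ ≤ 1) (hβ₀ : 0 ≤ β₀)
    (hβ₀θ : β₀ ≤ θ * β) (hH : 0 ≤ H) (hR : 0 ≤ R) (hF : IsAdmissible θ F) {i : Fin m} {j : Fin d}
    {D S : ℝ} (hD0 : 0 ≤ D) (hRS : R ≤ S)
    (hD : ∀ t ∈ Icc (0 : ℝ) 1, ∀ y z : Fin m → ℝ, ‖y‖ ≤ S → ‖z‖ ≤ S →
      ∀ x : Fin d → ℝ, ‖x‖ ≤ S → |F t y x i j - F t z x i j| ≤ D * ‖y - z‖ ∧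
      ∀ t' ∈ Icc (0 : ℝ) 1, ∀ y' z' : Fin m → ℝ, ‖y'‖ ≤ S → ‖z'‖ ≤ S →
      ∀ x' : Fin d → ℝ, ‖x'‖ ≤ S → x j = x' j →
        |F t y x i j - F t z x i j - (F t' y' x' i j - F t' z' x' i j)|
          ≤ D * (|t - t'| ^ θ + (‖y - y'‖ + ‖z - z'‖) ^ θ + ‖x - x'‖ ^ θ) * ‖y - z‖
            + D * ‖y - z - (y' - z')‖)
    {a b M W V : ℝ} (ha : 0 ≤ a) (hb : b ≤ T) (hM : 0 ≤ M) (hV : 0 ≤ V)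
    (hyS : ∀ u ∈ Icc a b, ‖y u‖ ≤ S) (hzS : ∀ u ∈ Icc a b, ‖z u‖ ≤ S)
    (hyM : ∀ u ∈ Icc a b, ∀ v ∈ Icc a b, ‖y u - y v‖ ≤ M * |u - v| ^ β)
    (hzM : ∀ u ∈ Icc a b, ∀ v ∈ Icc a b, ‖z u - z v‖ ≤ M * |u - v| ^ β)
    (hW : ∀ u ∈ Icc a b, ‖y u - z u‖ ≤ W)
    (hyz : ∀ u ∈ Icc a b, ∀ v ∈ Icc a b, ‖y u - z u - (y v - z v)‖ ≤ V * |u - v| ^ β) :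
    IsHolderIntegrand (fun u ξ => coefficient F x y i j u ξ - coefficient F x z i j u ξ) β₀
      (D * W) (D * (3 + H + 2 * M) * W + D * V) R a b := by
  have hsub : Icc a b ⊆ Icc 0 T := Icc_subset_Icc ha hb
  have hsub1 : Icc a b ⊆ Icc 0 1 := Icc_subset_Icc ha (hb.trans hT1)
  have hupd : ∀ t ∈ Icc a b, ∀ ξ, |ξ| ≤ R → ‖Function.update (x t) j ξ‖ ≤ S := fun t ht ξ hξ =>
    (norm_update_le hR (hx.bound t (hsub ht)) hξ j).trans hRS
  refine ⟨fun t ht => (hF.continuous_coefficient x y i j (hsub ht).1).sub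
    (hF.continuous_coefficient x z i j (hsub ht).1), fun t ht ξ hξ => ?_,
    fun s hs t ht ξ hξ => ?_⟩
  · refine (hD t (hsub1 ht) _ _ (hyS t ht) (hzS t ht) _ (hupd t ht ξ hξ)).1.trans ?_
    exact mul_le_mul_of_nonneg_left (hW t ht) hD0
  · refine ((hD s (hsub1 hs) _ _ (hyS s hs) (hzS s hs) _ (hupd s hs ξ hξ)).2 t (hsub1 ht) _ _
      (hyS t ht) (hzS t ht) _ (hupd t ht ξ hξ) (by simp)).trans ?_
    have h1 := hx.rpow_update_le hT1 hβα hα1 hθ hθ1 hβ₀ hβ₀θ hH (hsub hs) (hsub ht)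
      (n := ‖y s - y t‖ + ‖z s - z t‖) (L := 2 * M) (by positivity) (by positivity)
      (by linarith [hyM s hs t ht, hzM s hs t ht]) ξ j
    have hd : |s - t| ≤ 1 := by
      rw [abs_le]
      constructor <;> linarith [(hsub1 hs).1, (hsub1 hs).2, (hsub1 ht).1, (hsub1 ht).2]
    have h2 : |s - t| ^ β ≤ |s - t| ^ β₀ := Real.rpow_le_rpow_of_exponent_ge' (abs_nonneg _) hd hβ₀
      (hβ₀θ.trans (mul_le_of_le_one_left hβ.le hθ1))
    have h3 := (hyz s hs t ht).trans (mul_le_mul_of_nonneg_left h2 hV)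
    have h4 := mul_le_mul (mul_le_mul_of_nonneg_left h1 hD0) (hW s hs) (norm_nonneg _)
      (by positivity)
    have h5 := mul_le_mul_of_nonneg_left h3 hD0
    linarith

lemma IsHolderFrom.norm_le {E : Type*} [NormedAddCommGroup E] {M : ℝ} {y₀ : E} {y : ℝ → E}
    (hy : IsHolderFrom β T M y₀ y) (hβ : 0 ≤ β) (hT1 : T ≤ 1) (hM : 0 ≤ M) {t : ℝ}
    (ht : t ∈ Icc 0 T) : ‖y t‖ ≤ ‖y₀‖ + M := by
  have h1 := hy.holder t ht 0 ⟨le_rfl, ht.1.trans ht.2⟩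
  have h2 : |t - 0| ^ β ≤ 1 := Real.rpow_le_one (abs_nonneg _)
    (by rw [sub_zero, abs_of_nonneg ht.1]; exact ht.2.trans hT1) hβ
  rw [hy.initial] at h1
  have h3 := norm_add_le (y t - y₀) y₀
  rw [sub_add_cancel] at h3
  nlinarith

lemma norm_sum_le_of_abs_le {v : Fin m → Fin d → ℝ} {q : ℝ} (hq : 0 ≤ q) (h : ∀ i j, |v i j| ≤ q) :
    ‖fun i => ∑ j, v i j‖ ≤ d * q := by
  rw [pi_norm_le_iff_of_nonneg (by positivity)]
  intro i
  refine (Finset.abs_sum_le_sum_abs _ _).trans ?_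
  refine (Finset.sum_le_card_nsmul _ _ q fun j _ => h i j).trans ?_
  simp

/-- Every coefficient along a Hölder path is an admissible integrand on the whole of `[0, T]`. -/
lemma IsDriver.exists_isHolderIntegrand (hx : IsDriver x α β₀ ρ H R K T) (hT1 : T ≤ 1)
    (hβ : 0 < β) (hβα : β ≤ α) (hα1 : α ≤ 1) (hθ : 0 < θ) (hθ1 : θ ≤ 1) (hβ₀ : 0 ≤ β₀)
    (hβ₀θ : β₀ ≤ θ * β) (hH : 0 ≤ H) (hR : 0 ≤ R) (hF : IsAdmissible θ F) {M : ℝ} (hM : 0 ≤ M) :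
    ∃ A B, 0 ≤ A ∧ 0 ≤ B ∧ ∀ y, IsHolderFrom β T M y₀ y → ∀ i j,
      IsHolderIntegrand (coefficient F x y i j) β₀ A B R 0 T := by
  obtain ⟨A, hA0, hA⟩ := hF.exists_growth_const hθ hθ1 R
  obtain ⟨C, hC0, hC⟩ := hF.exists_holder_const R
  exact ⟨A * (1 + (‖y₀‖ + M)), C * (3 + H + M), by positivity, by positivity, fun y hy i j =>
    hx.isHolderIntegrand_coefficient hT1 hβα hα1 hθ.le hθ1 hβ₀ hβ₀θ hH hR hF hA0 hC0 (hA i j)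
      (hC i j) le_rfl le_rfl hM (fun u hu => hy.norm_le hβ.le hT1 hM hu) hy.holder⟩

lemma IsDriver.exists_hasGrowthBound (hx : IsDriver x α β₀ ρ H R K T) (hT1 : T ≤ 1)
    (hβ : 0 < β) (hβα : β ≤ α) (hα1 : α ≤ 1) (hθ : 0 < θ) (hθ1 : θ ≤ 1) (hβ₀ : 0 ≤ β₀)
    (hβ₀θ : β₀ ≤ θ * β) (hH : 0 ≤ H) (hR : 0 ≤ R) (hK : 0 ≤ K) (hF : IsAdmissible θ F) :
    ∃ c, 0 ≤ c ∧ HasGrowthBound β ρ T y₀ (solutionMap F x y₀) c := by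
  obtain ⟨A, hA0, hA⟩ := hF.exists_growth_const hθ hθ1 R
  obtain ⟨C, hC0, hC⟩ := hF.exists_holder_const R
  refine ⟨d * (K * (A + C * (3 + H))), by positivity, ?_⟩
  intro M y hy s t Y L hs hst ht hY hL hyY hyL
  obtain ⟨A', B', hA', hB', hint⟩ := hx.exists_isHolderIntegrand (y₀ := y₀) hT1 hβ hβα hα1 hθ hθ1
    hβ₀ hβ₀θ hH hR hF (abs_nonneg M)
  have hint := hint y (hy.mono (le_abs_self M))
  have hr : 0 < t - s := sub_pos.2 hst
  have p1 : (t - s) ^ α ≤ (t - s) ^ β :=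
    Real.rpow_le_rpow_of_exponent_ge hr (by linarith) hβα
  have p2 : 0 ≤ (t - s) ^ β := Real.rpow_nonneg hr.le _
  have p3 : 0 ≤ (t - s) ^ ρ := Real.rpow_nonneg hr.le _
  have hbound : K * (A * (1 + Y) * (t - s) ^ α + C * (3 + H + L) * (t - s) ^ ρ)
      ≤ K * (A + C * (3 + H)) * ((1 + Y) * (t - s) ^ β + (1 + L) * (t - s) ^ ρ) := by
    rw [mul_assoc K]
    refine mul_le_mul_of_nonneg_left ?_ hK
    have e1 : A * (1 + Y) * (t - s) ^ α ≤ (A + C * (3 + H)) * ((1 + Y) * (t - s) ^ β) := by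
      rw [mul_assoc]
      have : 0 ≤ C * (3 + H) := by positivity
      gcongr
      linarith
    have e2 : C * (3 + H + L) * (t - s) ^ ρ ≤ (A + C * (3 + H)) * ((1 + L) * (t - s) ^ ρ) := by
      rw [← mul_assoc]
      refine mul_le_mul_of_nonneg_right ?_ p3
      have q1 : 0 ≤ C * (2 + H) * L := by positivity
      have q2 : 0 ≤ A * (1 + L) := by positivity
      linarith
    linarith
  have e : solutionMap F x y₀ y t - solutionMap F x y₀ y s = fun i => ∑ j,
      (integralValue (coefficient F x y i j) (fun s => x s j) t
        - integralValue (coefficient F x y i j) (fun s => x s j) s) := by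
    ext i
    simp [solutionMap, Finset.sum_sub_distrib]
  rw [e, mul_assoc]
  refine norm_sum_le_of_abs_le (by positivity) fun i j => ?_
  refine (hx.abs_integralValue_sub_le hT1 (hβ.trans_le hβα) hA' hB' (hint i j) hs hst ht
    (by positivity) (by positivity) (hx.isHolderIntegrand_coefficient hT1 hβα hα1 hθ.le hθ1 hβ₀
      hβ₀θ hH hR hF hA0 hC0 (hA i j) (hC i j) hs ht hL hyY hyL)).trans hbound

lemma IsDriver.exists_hasLipschitzBound (hx : IsDriver x α β₀ ρ H R K T) (hT1 : T ≤ 1)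
    (hβ : 0 < β) (hβα : β ≤ α) (hα1 : α ≤ 1) (hθ : 0 < θ) (hθ1 : θ ≤ 1) (hβ₀ : 0 ≤ β₀)
    (hβ₀θ : β₀ ≤ θ * β) (hH : 0 ≤ H) (hR : 0 ≤ R) (hK : 0 ≤ K) (hF : IsAdmissible θ F) (M : ℝ) :
    ∃ c, 0 ≤ c ∧ HasLipschitzBound β ρ T y₀ (solutionMap F x y₀) M c := by
  obtain ⟨D, hD0, hD⟩ := hF.exists_sub_const hθ hθ1 (max R (‖y₀‖ + |M|))
  obtain ⟨A', B', hA', hB', hint⟩ := hx.exists_isHolderIntegrand (y₀ := y₀) hT1 hβ hβα hα1 hθ hθ1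
    hβ₀ hβ₀θ hH hR hF (abs_nonneg M)
  refine ⟨d * (K * (D * (3 + H + 2 * |M|))), by positivity, ?_⟩
  intro y z hy hz s t W V hs hst ht hW hV hyzW hyzV
  have hy' := hy.mono (le_abs_self M)
  have hz' := hz.mono (le_abs_self M)
  have hsub : Icc s t ⊆ Icc 0 T := Icc_subset_Icc hs ht
  have hr : 0 < t - s := sub_pos.2 hst
  have p1 : (t - s) ^ α ≤ (t - s) ^ β :=
    Real.rpow_le_rpow_of_exponent_ge hr (by linarith) hβα
  have p2 : 0 ≤ (t - s) ^ β := Real.rpow_nonneg hr.le _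
  have p3 : 0 ≤ (t - s) ^ ρ := Real.rpow_nonneg hr.le _
  have hQ : D ≤ D * (3 + H + 2 * |M|) :=
    le_mul_of_one_le_right hD0 (by linarith [abs_nonneg M])
  have hbound : K * (D * W * (t - s) ^ α + (D * (3 + H + 2 * |M|) * W + D * V) * (t - s) ^ ρ)
      ≤ K * (D * (3 + H + 2 * |M|)) * (W * (t - s) ^ β + (W + V) * (t - s) ^ ρ) := by
    rw [mul_assoc K]
    refine mul_le_mul_of_nonneg_left ?_ hK
    have e1 : D * W * (t - s) ^ α ≤ D * (3 + H + 2 * |M|) * (W * (t - s) ^ β) := by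
      rw [mul_assoc]
      exact mul_le_mul hQ (mul_le_mul_of_nonneg_left p1 hW) (by positivity) (by positivity)
    have e2 := mul_le_mul_of_nonneg_right (mul_le_mul_of_nonneg_right hQ hV) p3
    linarith
  have e : solutionMap F x y₀ y t - solutionMap F x y₀ z t
      - (solutionMap F x y₀ y s - solutionMap F x y₀ z s) = fun i => ∑ j,
      (integralValue (coefficient F x y i j) (fun s => x s j) t
        - integralValue (coefficient F x z i j) (fun s => x s j) t
        - (integralValue (coefficient F x y i j) (fun s => x s j) s
          - integralValue (coefficient F x z i j) (fun s => x s j) s)) := by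
    ext i
    simp [solutionMap, Finset.sum_sub_distrib]
  rw [e, mul_assoc]
  refine norm_sum_le_of_abs_le (by positivity) fun i j => ?_
  have hnorm : ∀ {y : ℝ → Fin m → ℝ}, IsHolderFrom β T |M| y₀ y → ∀ u ∈ Icc s t,
      ‖y u‖ ≤ max R (‖y₀‖ + |M|) := fun hy u hu =>
    (hy.norm_le hβ.le hT1 (abs_nonneg M) (hsub hu)).trans (le_max_right _ _)
  exact (hx.abs_integralValue_sub_sub_le hT1 (hβ.trans_le hβα) hA' hB' (hint y hy' i j)
    (hint z hz' i j) hs hst ht (by positivity) (by positivity)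
    (hx.isHolderIntegrand_coefficient_sub hT1 hβ hβα hα1 hθ.le hθ1 hβ₀ hβ₀θ hH hR hF hD0
      (le_max_left _ _) (hD i j) hs ht (abs_nonneg M) hV (hnorm hy') (hnorm hz')
      (fun u hu v hv => hy'.holder u (hsub hu) v (hsub hv))
      (fun u hu v hv => hz'.holder u (hsub hu) v (hsub hv)) hyzW hyzV)).trans hbound

/-- Solutions are exactly the Hölder paths from `y₀` that are fixed by the solution map. -/
lemma IsDriver.isSolution_iff (hx : IsDriver x α β₀ ρ H R K T) (hT : 0 ≤ T) (hT1 : T ≤ 1)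
    (hβ : 0 < β) (hβα : β ≤ α) (hα1 : α ≤ 1) (hθ : 0 < θ) (hθ1 : θ ≤ 1) (hβ₀ : 0 ≤ β₀)
    (hβ₀θ : β₀ ≤ θ * β) (hH : 0 ≤ H) (hR : 0 ≤ R) (hF : IsAdmissible θ F) :
    IsSolution β T F x y₀ y ↔
      ∃ M, 0 ≤ M ∧ IsHolderFrom β T M y₀ y ∧ EqOn (solutionMap F x y₀ y) y (Icc 0 T) := by
  constructor
  · rintro ⟨hHol, hsol⟩
    obtain ⟨M, hM0, hM⟩ := (memHolder_iff hβ.le).1 hHol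
    have hfix : EqOn (solutionMap F x y₀ y) y (Icc 0 T) := by
      intro t ht
      ext i
      obtain ⟨I, hI, hy⟩ := hsol t ht i
      rw [hy, solutionMap]
      congr 1
      exact Finset.sum_congr rfl fun j _ => (hI j).integralValue_eq
    refine ⟨M, hM0, ⟨?_, hM⟩, hfix⟩
    rw [← hfix ⟨le_rfl, hT⟩, solutionMap_zero]
  · rintro ⟨M, hM0, hM, hfix⟩
    refine ⟨(memHolder_iff hβ.le).2 ⟨M, hM0, hM.holder⟩, fun t ht i => ?_⟩
    obtain ⟨A, B, hA, hB, hint⟩ := hx.exists_isHolderIntegrand (y₀ := y₀) hT1 hβ hβα hα1 hθ hθ1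
      hβ₀ hβ₀θ hH hR hF hM0
    exact ⟨fun j => integralValue (coefficient F x y i j) (fun s => x s j) t,
      fun j => hx.hasIntegral hA hB (hint y hM i j) ht, (congrFun (hfix ht) i).symm⟩

end SolutionMap

end IrregularPath

theorem theorem3p2 {m d : ℕ} (T α β θ β₀ γ : ℝ)
    (hT : 0 < T) (hT1 : T ≤ 1)
    (hβ : 0 < β) (hβα : β ≤ α) (hα : α ≤ 1) (hθ : 0 < θ) (hθ1 : θ ≤ 1)
    (hγ : 0 < γ) (hβγ : 0 < β - γ) (hβ₀ : β - γ < β₀) (hβ₀θ : β₀ < θ * β)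
    (F : ℝ → (Fin m → ℝ) → (Fin d → ℝ) → Matrix (Fin m) (Fin d) ℝ)
    (hF : IrregularPath.IsAdmissible θ F)
    (x : ℝ → Fin d → ℝ) (hxG : IrregularPath.MemG β₀ γ T x)
    (hxα : IrregularPath.MemHolder α T x) (y₀ : Fin m → ℝ) :
    ∃ y : ℝ → Fin m → ℝ, IrregularPath.IsSolution β T F x y₀ y ∧
      ∀ z : ℝ → Fin m → ℝ, IrregularPath.IsSolution β T F x y₀ z → Set.EqOn z y (Set.Icc 0 T) := by
  have hβ₀0 : 0 ≤ β₀ := (hβγ.trans hβ₀).le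
  have hρ : β < β₀ + γ := by linarith
  obtain ⟨H, R, K, hH, hR, hK, hx⟩ := IrregularPath.exists_isDriver hT.le hT1 (hβ.trans_le hβα)
    hβ₀0 hxG hxα
  have hiff := fun y => hx.isSolution_iff (y := y) (y₀ := y₀) hT.le hT1 hβ hβα hα hθ hθ1 hβ₀0
    hβ₀θ.le hH hR hF
  have hlip := hx.exists_hasLipschitzBound (y₀ := y₀) hT1 hβ hβα hα hθ hθ1 hβ₀0 hβ₀θ.le hH hR hK hF
  obtain ⟨c, hc, hgrowth⟩ := hx.exists_hasGrowthBound (y₀ := y₀) hT1 hβ hβα hα hθ hθ1 hβ₀0 hβ₀θ.le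
    hH hR hK hF
  obtain ⟨M, y, hM, hy, hfix⟩ := IrregularPath.exists_fixedPoint hβ hρ hc hT.le
    (fun _ => IrregularPath.solutionMap_zero) hgrowth hlip
  refine ⟨y, (hiff y).2 ⟨M, hM, hy, hfix⟩, fun z hz => ?_⟩
  obtain ⟨M', hM', hz, hfixz⟩ := (hiff z).1 hz
  obtain ⟨c', hc', hl⟩ := hlip (max M M')
  exact IrregularPath.eqOn_of_fixedPoint hβ hρ hc' (hM.trans (le_max_left _ _)) hl
    (hz.mono (le_max_right _ _)) (hy.mono (le_max_left _ _)) hfixz hfix
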